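/- **Setting.** Let $\mathcal M$ be a family of probability measures $p$ on $\mathbb R$, with means $\mu_p$, such that for some $\tau>0$ $$\inf_{p\in\mathcal M}\mu_p>0,\qquad M_\tau:=\sup_{p\in\mathcal M}\int e^{\tau|x|}\,p(dx)<\infty .$$ Suppose that each $p\in\mathcal M$ is a mixture $p=(1-\lambda_p)\Phi_p+\lambda_p\Psi_p$ of two probability measures, where $0\le\lambda_p<1$, $\sup_{p}\lambda_p<1$, and $\Phi_p$ has a density $\phi_p\ge 0$; and suppose that there is $T\in(0,\infty)$ such that every $\phi_p$ is of class $C^2$ with compact support in $(-T,T)$, and $\sup_p\int_{-T}^T|\phi_p''(x)|\,dx<\infty$. Let $$N_p=\sum_{n\ge0}p^{n*},\qquad \bar N_p=\sum_{n\ge0}\lambda_p^n\Psi_p^{n*},\qquad q_p(x)=(1-\lambda_p)\int\phi_p(x-y)\,(\bar N_p*N_p)(dy),$$ where $p^{n*}$ is the $n$-fold convolution of $p$ and $p^{0*}=\delta_0$. For $r>0$ let $$A_1(r)=\sup_{x>0,\,p\in\mathcal M}e^{rx}|q_p(x)-\mu_p^{-1}|+\sup_{x>0,\,p\in\mathcal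 M}e^{rx}q_p(-x),$$ $$A_2(r)=\sup_{x>0,\,p\in\mathcal M}e^{rx}\bar N_p\big((-\infty,-x]\cup[x,\infty)\big).$$ For $p\in\mathcal M$ let $z_p$ be a real function on $[0,\infty)$, and let $\eta\in(0,\tau)$ be such that $L_1:=\sup_{x\ge0,\,p\in\mathcal M}e^{\eta x}|z_p(x)|<\infty$. Consider the renewal equation $$Z_p(x)=z_p(x)+\int_{(-\infty,x]}Z_p(x-y)\,p(dy)\qquad\forall x\ge0,\ p\in\mathcal M, \tag{1}$$ for Borel functions $Z_p:[0,\infty)\to\mathbb R$ for which these integrals converge absolutely, subject to the growth condition $$L_2(\varepsilon):=\sup_{x\ge0,\,p\in\mathcal M}e^{-\varepsilon x}|Z_p(x)|<\infty\qquad\forall\varepsilon>0. \tag{2}$$ **Corollary 1.2.** There is a function $C(a_1,a_2,l,\eta,r)$, defined and continuous for $a_1,a_2,l\ge0$ and $\eta,r>0$, which does not depend on anything else (in particular not on $\mathcal M$, $z_p$, $Z_p$), such that for every family $\mathcal M$ as above the following hold. 1. $N_p$ is the sum of $\bar N_p$ and the measure with density $q_p$, for every $p\in\mathcal M$. 2.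 For all $\eta$ and $(z_p)$ as above, (1) has at most one solution $(Z_p)_{p\in\mathcal M}$ satisfying (2). 3. For all $\eta$ and $(z_p)$ as above, if $(Z_p)$ is a solution of (1) satisfying (2), then for every $p\in\mathcal M$, as $x\to\infty$, $$Z_p(x)\to u_p:=\frac1{\mu_p}\left[\int_0^\infty z_p(x)\,dx-\int_{(-\infty,0]}\Big(\int_0^{|y|}Z_p(x)\,dx\Big)p(dy)\right].$$ 4. There is $r_0>0$, depending only on $\mathcal M$ (with the given mixtures), such that for all $r\in(0,r_0)$: $A_1(r)<\infty$, $A_2(r)<\infty$, and for all $\eta$ and $(z_p)$ as above and every solution $(Z_p)$ of (1) satisfying (2), with $\alpha=\tfrac12\min(\eta,r)$ and $L=\max\big(L_1,\,L_2(\eta)M_\tau\big)$, $$\sup_{x>0,\,p\in\mathcal M}e^{\alpha x}|Z_p(x)-u_p|\le C\big(A_1(r),A_2(r),L,\eta,r\big).$$ -/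

import Mathlib

open MeasureTheory Set Filter Topology
open scoped ENNReal

noncomputable section

namespace UniformRenewal

/-- The `n`-fold convolution of a measure on `ℝ` with itself; the `0`-fold one is the Dirac mass
at `0`. -/
def convPow (μ : Measure ℝ) : ℕ → Measure ℝ
  | 0 => Measure.dirac 0
  | n + 1 => Measure.conv (convPow μ n) μ

/-- The mean of a measure on `ℝ`. -/
def mean (p : Measure ℝ) : ℝ := ∫ x, x ∂p

/-- The renewal measure `N_p`, the sum over `n ≥ 0` of the `n`-fold convolutions of `p`. -/
def renewalMeasure (p : Measure ℝ) : Measure ℝ := Measure.sum fun n => convPow p n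

/-- The finite part `∑ lamⁿ Ψ^{n*}` of the renewal measure of `(1 - lam) Φ + lam Ψ`. -/
def finitePart (lam : ℝ) (Ψ : Measure ℝ) : Measure ℝ :=
  Measure.sum fun n => ENNReal.ofReal lam ^ n • convPow Ψ n

/-- The continuous version of the density of `(1 - lam) Φ * (∑ lamⁿ Ψ^{n*}) * N_p`, where `Φ` has
density `φ`. -/
def renewalDensity (p : Measure ℝ) (lam : ℝ) (φ : ℝ → ℝ) (Ψ : Measure ℝ) (x : ℝ) : ℝ :=
  (1 - lam) * ∫ y, φ (x - y) ∂(Measure.conv (finitePart lam Ψ) (renewalMeasure p))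

variable {ι : Type*}

/-- `M_τ`, the supremum over the family of the exponential moments `E_p[exp (τ |X|)]`. -/
def expMoment (p : ι → Measure ℝ) (τ : ℝ) : ℝ≥0∞ :=
  ⨆ i, ∫⁻ x, ENNReal.ofReal (Real.exp (τ * |x|)) ∂(p i)

/-- A family of probability measures `p i = (1 - lam i) Φ i + lam i Ψ i`, where `Φ i` has
density `φ i`, with means bounded away from `0`, uniformly bounded exponential moments of order `τ`,
weights `lam i` bounded away from `1`, and densities `φ i` of class `C²` with compact support
in `(-T, T)` whose second derivatives are bounded in `L¹`. -/
structure IsUniformFamily (p : ι → Measure ℝ) (lam : ι → ℝ) (φ : ι → ℝ → ℝ) (Ψ : ι → Measure ℝ)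
    (τ T : ℝ) : Prop where
  prob : ∀ i, IsProbabilityMeasure (p i)
  prob_left : ∀ i, IsProbabilityMeasure (volume.withDensity fun x => ENNReal.ofReal (φ i x))
  prob_right : ∀ i, IsProbabilityMeasure (Ψ i)
  tau_pos : 0 < τ
  T_pos : 0 < T
  mean_pos : ∃ m > 0, ∀ i, m ≤ mean (p i)
  expMoment_lt_top : expMoment p τ < ∞
  lam_mem : ∀ i, 0 ≤ lam i ∧ lam i < 1
  mixture : ∀ i, p i =
    ENNReal.ofReal (1 - lam i) • (volume.withDensity fun x => ENNReal.ofReal (φ i x))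
      + ENNReal.ofReal (lam i) • Ψ i
  lam_le : ∃ γ < 1, ∀ i, lam i ≤ γ
  phi_nonneg : ∀ i x, 0 ≤ φ i x
  phi_contDiff : ∀ i, ContDiff ℝ 2 (φ i)
  phi_tsupport : ∀ i, tsupport (φ i) ⊆ Ioo (-T) T
  phi_deriv_two : ∃ B : ℝ, ∀ i, ∫ x in (-T)..T, |iteratedDeriv 2 (φ i) x| ≤ B

/-- `A₁ = sup_{x > 0, p} e^{r x} |q_p(x) - 1/μ_p| + sup_{x > 0, p} e^{r x} q_p(-x)`. -/
def A₁ (p : ι → Measure ℝ) (lam : ι → ℝ) (φ : ι → ℝ → ℝ) (Ψ : ι → Measure ℝ) (r : ℝ) : ℝ≥0∞ :=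
  (⨆ i, ⨆ x ∈ Ioi (0 : ℝ), ENNReal.ofReal
    (Real.exp (r * x) * |renewalDensity (p i) (lam i) (φ i) (Ψ i) x - (mean (p i))⁻¹|))
  + ⨆ i, ⨆ x ∈ Ioi (0 : ℝ), ENNReal.ofReal
    (Real.exp (r * x) * renewalDensity (p i) (lam i) (φ i) (Ψ i) (-x))

/-- `A₂ = sup_{x > 0, p} e^{r x} N̄_p((-∞, -x] ∪ [x, ∞))`, where `N̄_p` is the finite part. -/
def A₂ (lam : ι → ℝ) (Ψ : ι → Measure ℝ) (r : ℝ) : ℝ≥0∞ :=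
  ⨆ i, ⨆ x ∈ Ioi (0 : ℝ),
    ENNReal.ofReal (Real.exp (r * x)) * finitePart (lam i) (Ψ i) (Iic (-x) ∪ Ici x)

/-- `sup_{x ≥ 0, p} e^{s x} |f_p(x)|`. Only the values of `f_p` on `[0, ∞)` matter.
It is `L₁` for `f = z`, `s = η`, and `L₂(ε)` for `f = Z`, `s = -ε`. -/
def expSup (s : ℝ) (f : ι → ℝ → ℝ) : ℝ≥0∞ :=
  ⨆ i, ⨆ x ∈ Ici (0 : ℝ), ENNReal.ofReal (Real.exp (s * x) * |f i x|)

/-- `Z`, a Borel function on `[0, ∞)`, solves `Z(x) = z(x) + ∫_{(-∞, x]} Z(x - y) p(dy)` for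
all `x ≥ 0`. Only the values of `z` and `Z` on `[0, ∞)` matter. -/
structure IsRenewalSolution (p : Measure ℝ) (z Z : ℝ → ℝ) : Prop where
  measurable : Measurable fun x : Ici (0 : ℝ) => Z x
  integrable : ∀ x, 0 ≤ x → IntegrableOn (fun y => Z (x - y)) (Iic x) p
  eq : ∀ x, 0 ≤ x → Z x = z x + ∫ y in Iic x, Z (x - y) ∂p

/-- `Z` is a solution for each member of the family, of uniformly subexponential growth:
`sup_{x ≥ 0, p} e^{-ε x} |Z_p(x)| < ∞` for all `ε > 0`. -/
def IsSubexpSolution (p : ι → Measure ℝ) (z Z : ι → ℝ → ℝ) : Prop :=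
  (∀ i, IsRenewalSolution (p i) (z i) (Z i)) ∧ ∀ ε > 0, expSup (-ε) Z < ∞

/-- The limit `u_p = (1/μ_p) [∫_0^∞ z(x) dx - ∫_{(-∞, 0]} (∫_0^{|y|} Z(x) dx) p(dy)]`. -/
def renewalLimit (p : Measure ℝ) (z Z : ℝ → ℝ) : ℝ :=
  (mean p)⁻¹ * ((∫ x in Ioi (0 : ℝ), z x) - ∫ y in Iic (0 : ℝ), (∫ x in (0 : ℝ)..|y|, Z x) ∂p)

end UniformRenewal

end

/-!
Write `p = f(x) dx + ν` with `f = (1 - λ) φ` and `ν = λ Ψ`. Then `N̄_p` is the renewal measure of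
`ν`, and `N_p = N̄_p + f dx * N̄_p * N_p` (`renewalMeasure_splitting`), which exhibits `q_p`.
All estimates are made for a single `p` with constants that depend on a record of bounds only
(`Bounds`, `IsSmoothSplitting`), so that they are uniform over the family.

**Decay of `q_p`.** The Laplace transform of `q_p` is `f̂ / ((1 - ν̂) (1 - p̂))` on the right of the
imaginary axis. In a narrow strip around the axis, `|ν̂|` stays below `1 - δ / 2`, and `1 - p̂`
vanishes only at `0`, to first order with derivative `μ_p`, and is otherwise bounded below
(`exists_spectral_gap`). The latter is uniform in `p`, because `1 - cos 2t ≤ 4 (1 - cos t)` carries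
lower bounds from high frequencies, where `f̂` is small by two integrations by parts, down to any
fixed frequency. Subtracting the transform of `(1 - exp (-x))₊ / μ_p` removes the pole and leaves a
function with quadratic decay on vertical lines. Fourier inversion and a shift of the contour to
`Re s = -r` show that `q_p(x) - 1 / μ_p` is of the order `exp (-r x)` (`abs_density_sub_le`).

**Solutions.** Extended by zero to the line, a solution `Z` has a defect `Z - p * Z`, equal to `z`
on `[0, ∞)` and bounded by `L exp (-η |x|)`. Convolution with `p` is a contraction in the norm
`sup exp (-ε x) |W(x)|` for small `ε > 0`. This gives uniqueness, and it gives
`Z = N_p * (Z - p * Z)` (`extend_eq_integral`). The limit `u_p` is `1 / μ_p` times the integral of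
the defect.

**The rate.** Inserting the splitting of `N_p` into this formula, everything is controlled by `A₁`,
`A₂`, `L`, `η` and `r` except for the term `k z(x)` that stems from the atom of `N̄_p` at `0`, of
mass `k` (`abs_sub_sub_atom_le`). A large `k` means that `p` is concentrated at `0`. As the mean is
bounded below by `1 / A₁`, the exponential moment `M_τ` is then exponentially large in `k`, so that
the bound on `L₂(η) M_τ` forces `Z` to be tiny on a long interval, past which `k z(x)` is harmless
(`IsSmoothSplitting.exp_mul_abs_sub_le`).
-/

namespace UniformRenewal

/-! ### Renewal measures of finite measures -/

instance isFiniteMeasure_convPow (ν : Measure ℝ) [IsFiniteMeasure ν] (n : ℕ) :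
    IsFiniteMeasure (convPow ν n) := by
  induction n with
  | zero => rw [convPow]; infer_instance
  | succ n ih => rw [convPow]; infer_instance

instance sFinite_renewalMeasure (ν : Measure ℝ) [IsFiniteMeasure ν] :
    SFinite (renewalMeasure ν) := by
  rw [renewalMeasure]; infer_instance

lemma sum_conv {κ : Type*} [Countable κ] (m : κ → Measure ℝ) (ν : Measure ℝ) [SFinite ν] :
    (Measure.sum m).conv ν = Measure.sum fun i => (m i).conv ν := by
  simp only [Measure.conv]
  rw [Measure.prod_sum_left, Measure.map_sum (by fun_prop)]

/-- The renewal equation for the renewal measure itself. -/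
lemma renewalMeasure_eq (ν : Measure ℝ) [IsFiniteMeasure ν] :
    renewalMeasure ν = Measure.dirac 0 + (renewalMeasure ν).conv ν := by
  have h : (renewalMeasure ν).conv ν = Measure.sum fun n => convPow ν (n + 1) := by
    rw [renewalMeasure, sum_conv]; rfl
  rw [h, renewalMeasure]
  ext s hs
  rw [Measure.add_apply, Measure.sum_apply _ hs, Measure.sum_apply _ hs,
    tsum_eq_zero_add' ENNReal.summable]
  rfl

lemma convPow_smul (c : ℝ≥0∞) (ν : Measure ℝ) [IsFiniteMeasure ν] (n : ℕ) :
    convPow (c • ν) n = c ^ n • convPow ν n := by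
  induction n with
  | zero => simp [convPow]
  | succ n ih =>
    rw [convPow, ih, convPow, Measure.conv_smul_left, Measure.conv_smul_right, smul_smul, pow_succ]

lemma finitePart_eq (lam : ℝ) (Ψ : Measure ℝ) [IsFiniteMeasure Ψ] :
    finitePart lam Ψ = renewalMeasure (ENNReal.ofReal lam • Ψ) := by
  simp only [finitePart, renewalMeasure, convPow_smul]

lemma lintegral_conv_le {h : ℝ → ℝ≥0∞} (hm : Measurable h) (hmul : ∀ x y, h (x + y) ≤ h x * h y)
    (μ ν : Measure ℝ) [SFinite ν] :
    ∫⁻ x, h x ∂(μ.conv ν) ≤ (∫⁻ x, h x ∂μ) * ∫⁻ x, h x ∂ν := by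
  rw [Measure.lintegral_conv hm, ← lintegral_mul_const _ hm]
  refine lintegral_mono fun x => ?_
  rw [← lintegral_const_mul _ hm]
  exact lintegral_mono fun y => hmul x y

lemma lintegral_renewalMeasure_le {h : ℝ → ℝ≥0∞} (hm : Measurable h)
    (hmul : ∀ x y, h (x + y) ≤ h x * h y) (h0 : h 0 ≤ 1) (ν : Measure ℝ) [IsFiniteMeasure ν] :
    ∫⁻ x, h x ∂(renewalMeasure ν) ≤ (1 - ∫⁻ x, h x ∂ν)⁻¹ := by
  rw [renewalMeasure, lintegral_sum_measure, ← ENNReal.tsum_geometric]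
  refine ENNReal.tsum_le_tsum fun n => ?_
  induction n with
  | zero => simpa [convPow, lintegral_dirac' _ hm] using h0
  | succ n ih =>
    rw [convPow, pow_succ]
    exact (lintegral_conv_le hm hmul _ _).trans (by gcongr)

lemma renewalMeasure_univ_mul_le (ν : Measure ℝ) [IsFiniteMeasure ν] :
    (1 - ν univ) * renewalMeasure ν univ ≤ 1 := by
  have := lintegral_renewalMeasure_le (h := fun _ => 1) measurable_const (by simp) le_rfl ν
  simp only [lintegral_const, one_mul] at this
  calc _ ≤ (1 - ν univ) * (1 - ν univ)⁻¹ := by gcongr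
    _ ≤ 1 := ENNReal.mul_inv_le_one _

/-! ### Laplace transforms -/

/-- The weight `exp (-ε y)` as an extended nonnegative real. -/
noncomputable def tilt (ε y : ℝ) : ℝ≥0∞ := ENNReal.ofReal (Real.exp (-(ε * y)))

/-- The weight `exp (σ |y|)` as an extended nonnegative real. -/
noncomputable def absTilt (σ y : ℝ) : ℝ≥0∞ := ENNReal.ofReal (Real.exp (σ * |y|))

@[fun_prop]
lemma measurable_tilt (ε : ℝ) : Measurable (tilt ε) := by unfold tilt; fun_prop

@[fun_prop]
lemma measurable_absTilt (σ : ℝ) : Measurable (absTilt σ) := by unfold absTilt; fun_prop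

lemma tilt_add (ε x y : ℝ) : tilt ε (x + y) = tilt ε x * tilt ε y := by
  rw [tilt, tilt, tilt, ← ENNReal.ofReal_mul (Real.exp_nonneg _), ← Real.exp_add]
  ring_nf

lemma absTilt_add_le {σ : ℝ} (hσ : 0 ≤ σ) (x y : ℝ) :
    absTilt σ (x + y) ≤ absTilt σ x * absTilt σ y := by
  rw [absTilt, absTilt, absTilt, ← ENNReal.ofReal_mul (Real.exp_nonneg _), ← Real.exp_add]
  gcongr
  rw [← mul_add]
  exact mul_le_mul_of_nonneg_left (abs_add_le x y) hσ

lemma tilt_le_absTilt {ε σ : ℝ} (h : |ε| ≤ σ) (y : ℝ) : tilt ε y ≤ absTilt σ y := by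
  rw [tilt, absTilt]
  gcongr
  calc -(ε * y) ≤ |ε * y| := neg_le_abs _
    _ = |ε| * |y| := abs_mul _ _
    _ ≤ σ * |y| := by gcongr

/-- The two-sided Laplace transform `∫ exp (-s y) ν(dy)`. -/
noncomputable def laplace (ν : Measure ℝ) (s : ℂ) : ℂ := ∫ y : ℝ, Complex.exp (-s * y) ∂ν

lemma norm_cexp_neg_mul (s : ℂ) (y : ℝ) :
    ‖Complex.exp (-s * y)‖ = Real.exp (-(s.re * y)) := by
  rw [Complex.norm_exp]; simp

lemma enorm_cexp_neg_mul (s : ℂ) (y : ℝ) : ‖Complex.exp (-s * y)‖ₑ = tilt s.re y := by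
  rw [tilt, ← norm_cexp_neg_mul, ofReal_norm]

lemma integrable_cexp {ν : Measure ℝ} {s : ℂ} (h : ∫⁻ y, tilt s.re y ∂ν < ∞) :
    Integrable (fun y : ℝ => Complex.exp (-s * y)) ν := by
  refine ⟨by fun_prop, ?_⟩
  rw [HasFiniteIntegral]
  simpa only [enorm_cexp_neg_mul] using h

lemma integrable_tilt {ν : Measure ℝ} {ε : ℝ} (h : ∫⁻ y, tilt ε y ∂ν < ∞) :
    Integrable (fun y : ℝ => Real.exp (-(ε * y))) ν := by
  refine ⟨by fun_prop, ?_⟩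
  rw [HasFiniteIntegral]
  simpa only [Real.enorm_eq_ofReal (Real.exp_nonneg _), tilt] using h

lemma integral_tilt {ν : Measure ℝ} {ε : ℝ} :
    ∫ y, Real.exp (-(ε * y)) ∂ν = (∫⁻ y, tilt ε y ∂ν).toReal := by
  rw [integral_eq_lintegral_of_nonneg_ae (.of_forall fun _ => Real.exp_nonneg _) (by fun_prop)]
  rfl

lemma norm_laplace_le {ν : Measure ℝ} {s : ℂ} :
    ‖laplace ν s‖ ≤ (∫⁻ y, tilt s.re y ∂ν).toReal := by
  rw [← integral_tilt]
  refine (norm_integral_le_integral_norm _).trans (le_of_eq ?_)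
  simp only [norm_cexp_neg_mul]

lemma laplace_conv {μ ν : Measure ℝ} [SFinite μ] [SFinite ν] {s : ℂ}
    (hμ : ∫⁻ y, tilt s.re y ∂μ < ∞) (hν : ∫⁻ y, tilt s.re y ∂ν < ∞) :
    laplace (μ.conv ν) s = laplace μ s * laplace ν s := by
  have h : ∫⁻ y, tilt s.re y ∂(μ.conv ν) < ∞ :=
    (lintegral_conv_le (measurable_tilt _) (fun x y => (tilt_add _ x y).le) μ ν).trans_lt
      (ENNReal.mul_lt_top hμ hν)
  rw [laplace, integral_conv (integrable_cexp h), laplace, ← integral_mul_const]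
  congr 1 with x
  rw [laplace, ← integral_const_mul]
  congr 1 with y
  rw [← Complex.exp_add]; push_cast; ring_nf

lemma laplace_add {μ ν : Measure ℝ} {s : ℂ}
    (hμ : ∫⁻ y, tilt s.re y ∂μ < ∞) (hν : ∫⁻ y, tilt s.re y ∂ν < ∞) :
    laplace (μ + ν) s = laplace μ s + laplace ν s :=
  integral_add_measure (integrable_cexp hμ) (integrable_cexp hν)

lemma lintegral_tilt_renewalMeasure_le (ν : Measure ℝ) [IsFiniteMeasure ν] (ε : ℝ) :
    ∫⁻ x, tilt ε x ∂(renewalMeasure ν) ≤ (1 - ∫⁻ x, tilt ε x ∂ν)⁻¹ :=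
  lintegral_renewalMeasure_le (measurable_tilt ε) (fun x y => (tilt_add ε x y).le)
    (by simp [tilt]) ν

lemma lintegral_tilt_renewalMeasure_lt_top {ν : Measure ℝ} [IsFiniteMeasure ν] {ε : ℝ}
    (h : ∫⁻ x, tilt ε x ∂ν < 1) : ∫⁻ x, tilt ε x ∂(renewalMeasure ν) < ∞ :=
  (lintegral_tilt_renewalMeasure_le ν ε).trans_lt (by simpa using h)

lemma laplace_renewalMeasure_mul {ν : Measure ℝ} [IsFiniteMeasure ν] {s : ℂ}
    (h : ∫⁻ x, tilt s.re x ∂ν < 1) :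
    laplace (renewalMeasure ν) s * (1 - laplace ν s) = 1 := by
  have hN := lintegral_tilt_renewalMeasure_lt_top h
  have hν := h.trans ENNReal.one_lt_top
  have hc : ∫⁻ y, tilt s.re y ∂((renewalMeasure ν).conv ν) < ∞ :=
    (lintegral_conv_le (measurable_tilt _) (fun x y => (tilt_add _ x y).le) _ _).trans_lt
      (ENNReal.mul_lt_top hN hν)
  have h1 : laplace (renewalMeasure ν) s = 1 + laplace (renewalMeasure ν) s * laplace ν s := by
    conv_lhs => rw [renewalMeasure_eq ν]
    rw [laplace_add _ hc, laplace_conv hN hν]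
    · simp [laplace]
    · rw [lintegral_dirac' _ (measurable_tilt _)]; simp [tilt]
  linear_combination h1

/-! ### The splitting of the renewal measure -/

/-- Cancellation in `α + γ = β + γ` for measures on `ℝ`, when `γ` has a finite exponential
moment. -/
lemma measure_add_right_cancel {α β γ : Measure ℝ} {ε : ℝ} (hγ : ∫⁻ y, tilt ε y ∂γ < ∞)
    (h : α + γ = β + γ) : α = β := by
  have key : ∀ (A : ℕ) (s : Set ℝ), MeasurableSet s →
      α (s ∩ Icc (-A : ℝ) A) = β (s ∩ Icc (-A : ℝ) A) := by
    intro A s hs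
    have hfin : γ (s ∩ Icc (-A : ℝ) A) ≠ ∞ := by
      have h1 : ENNReal.ofReal (Real.exp (-(|ε| * A))) * γ (s ∩ Icc (-A : ℝ) A) < ∞ := by
        refine lt_of_le_of_lt ?_ hγ
        rw [← setLIntegral_const]
        refine (setLIntegral_mono (measurable_tilt ε) fun y hy => ?_).trans
          (setLIntegral_le_lintegral _ _)
        rw [tilt]
        refine ENNReal.ofReal_le_ofReal (Real.exp_le_exp.2 (neg_le_neg ?_))
        calc ε * y ≤ |ε * y| := le_abs_self _
          _ = |ε| * |y| := abs_mul _ _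
          _ ≤ |ε| * A := by gcongr; exact abs_le.2 hy.2
      intro h2
      rw [h2, ENNReal.mul_top (by simp [Real.exp_pos])] at h1
      exact lt_irrefl _ h1
    have := congrArg (fun m : Measure ℝ => m (s ∩ Icc (-A : ℝ) A)) h
    simp only [Measure.add_apply] at this
    exact (ENNReal.add_left_inj hfin).1 this
  ext s hs
  have hU : s = ⋃ A : ℕ, s ∩ Icc (-A : ℝ) A := by
    rw [← inter_iUnion]
    refine (inter_eq_left.2 fun x _ => ?_).symm
    obtain ⟨n, hn⟩ := exists_nat_ge |x|
    exact mem_iUnion.2 ⟨n, abs_le.1 hn⟩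
  have hmono : Monotone fun A : ℕ => s ∩ Icc (-A : ℝ) A := fun a b hab => by
    refine inter_subset_inter_right _ (Icc_subset_Icc ?_ ?_)
    · exact neg_le_neg (by exact_mod_cast hab)
    · exact_mod_cast hab
  rw [hU, hmono.measure_iUnion, hmono.measure_iUnion]
  simp only [key _ s hs]

/-- If `p = β + ν` then `N_p = N_ν + β * (N_ν * N_p)`. -/
lemma renewalMeasure_splitting {p β ν : Measure ℝ} [IsFiniteMeasure p] [IsFiniteMeasure β]
    [IsFiniteMeasure ν] (hp : p = β + ν) {ε : ℝ} (h : ∫⁻ y, tilt ε y ∂p < 1) :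
    renewalMeasure p =
      β.conv ((renewalMeasure ν).conv (renewalMeasure p)) + renewalMeasure ν := by
  set N := renewalMeasure p with hN
  set K := renewalMeasure ν with hK
  have hνp : ∫⁻ y, tilt ε y ∂ν ≤ ∫⁻ y, tilt ε y ∂p := by
    rw [hp, lintegral_add_measure]; exact le_add_self
  have hsub : ∀ x y, tilt ε (x + y) ≤ tilt ε x * tilt ε y := fun x y => (tilt_add ε x y).le
  have hfin : ∫⁻ y, tilt ε y ∂(ν.conv (K.conv N)) < ∞ := by
    refine (lintegral_conv_le (measurable_tilt _) hsub _ _).trans_lt (ENNReal.mul_lt_top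
      ((hνp.trans_lt h).trans ENNReal.one_lt_top) ?_)
    exact (lintegral_conv_le (measurable_tilt _) hsub _ _).trans_lt (ENNReal.mul_lt_top
      (lintegral_tilt_renewalMeasure_lt_top (hνp.trans_lt h))
      (lintegral_tilt_renewalMeasure_lt_top h))
  refine measure_add_right_cancel hfin ?_
  -- Both sides are `N_ν * N_p`, expanded by the equation for `N_ν` and by the one for `N_p`.
  have h1 : K.conv N = N + ν.conv (K.conv N) := by
    conv_lhs => rw [hK, renewalMeasure_eq ν, ← hK]
    rw [Measure.add_conv, Measure.dirac_zero_conv, Measure.conv_comm K ν, Measure.conv_assoc]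
  have h2 : K.conv N = β.conv (K.conv N) + K + ν.conv (K.conv N) := by
    conv_lhs => rw [hN, renewalMeasure_eq p, ← hN]
    rw [Measure.conv_add, Measure.conv_dirac_zero, ← Measure.conv_assoc,
      Measure.conv_comm _ p, hp, Measure.add_conv]
    abel
  rw [← h1, ← h2]

/-- The density of the convolution of `f(x) dx` with a measure. -/
lemma withDensity_conv {f : ℝ → ℝ≥0∞} (hf : Measurable f) (κ : Measure ℝ) [SFinite κ] :
    (volume.withDensity f).conv κ = volume.withDensity fun x => ∫⁻ y, f (x - y) ∂κ := by
  refine Measure.ext_of_lintegral _ fun g hg => ?_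
  have hm : Measurable fun x : ℝ × ℝ => f (x.1 - x.2) := by fun_prop
  rw [Measure.lintegral_conv hg, lintegral_withDensity_eq_lintegral_mul _ hf
      (by fun_prop), lintegral_withDensity_eq_lintegral_mul _ (by fun_prop) hg]
  simp only [Pi.mul_apply]
  have hm1 : Measurable (Function.uncurry fun x y : ℝ => f x * g (x + y)) := by
    unfold Function.uncurry; fun_prop
  have hm2 : Measurable (Function.uncurry fun x y : ℝ => f (x - y) * g x) := by
    unfold Function.uncurry; fun_prop
  calc ∫⁻ x, (f x * ∫⁻ y, g (x + y) ∂κ) = ∫⁻ x, (∫⁻ y, f x * g (x + y) ∂κ) := by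
        congr 1 with x; rw [lintegral_const_mul _ (by fun_prop)]
    _ = ∫⁻ y, (∫⁻ x, f x * g (x + y)) ∂κ := lintegral_lintegral_swap hm1.aemeasurable
    _ = ∫⁻ y, (∫⁻ x, f (x - y) * g x) ∂κ := by
        congr 1 with y
        rw [← lintegral_sub_right_eq_self (μ := volume) (fun x => f x * g (x + y)) y]
        simp
    _ = ∫⁻ x, (∫⁻ y, f (x - y) * g x ∂κ) := (lintegral_lintegral_swap hm2.aemeasurable).symm
    _ = _ := by congr 1 with x; rw [lintegral_mul_const _ (by fun_prop)]

/-! ### Smooth splittings with uniform bounds -/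

/-- The constants on which all estimates for one member of a uniform family depend: a lower bound
`m` for the mean, the order `τ` and a bound `M` for the exponential moment, the support `(-T, T)`
of the smooth part, a lower bound `δ` for its mass, and a bound `B` for the `L¹` norm of its second
derivative. -/
structure Bounds where
  m : ℝ
  τ : ℝ
  T : ℝ
  δ : ℝ
  M : ℝ
  B : ℝ
  m_pos : 0 < m
  τ_pos : 0 < τ
  T_pos : 0 < T
  δ_pos : 0 < δ
  δ_le : δ ≤ 1
  M_pos : 0 < M
  B_pos : 0 < B

/-- The probability measure `p` is the sum of `f(x) dx` and `ν`, with the bounds `b`. In terms of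
a mixture `p = (1 - λ) Φ + λ Ψ`, `f` is `(1 - λ)` times the density of `Φ`, and `ν = λ Ψ`. -/
structure IsSmoothSplitting (b : Bounds) (p ν : Measure ℝ) (f : ℝ → ℝ) : Prop where
  prob : IsProbabilityMeasure p
  split : p = (volume.withDensity fun x => ENNReal.ofReal (f x)) + ν
  mean_ge : b.m ≤ mean p
  moment_le : ∫⁻ x, absTilt b.τ x ∂p ≤ ENNReal.ofReal b.M
  nonneg : ∀ x, 0 ≤ f x
  contDiff : ContDiff ℝ 2 f
  tsupport_subset : tsupport f ⊆ Ioo (-b.T) b.T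
  deriv_two_le : ∫ x in (-b.T)..b.T, |iteratedDeriv 2 f x| ≤ b.B
  mass_le : ν univ ≤ ENNReal.ofReal (1 - b.δ)

lemma abs_le_exp {τ : ℝ} (hτ : 0 < τ) (y : ℝ) : |y| ≤ 2 / τ * Real.exp (τ / 2 * |y|) := by
  have h := Real.add_one_le_exp (τ / 2 * |y|)
  calc |y| = 2 / τ * (τ / 2 * |y|) := by field_simp
    _ ≤ _ := by gcongr; linarith

lemma sq_le_exp {τ : ℝ} (hτ : 0 < τ) (y : ℝ) : |y| ^ 2 ≤ 8 / τ ^ 2 * Real.exp (τ / 2 * |y|) := by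
  have h := Real.quadratic_le_exp_of_nonneg (x := τ / 2 * |y|) (by positivity)
  calc |y| ^ 2 = 8 / τ ^ 2 * ((τ / 2 * |y|) ^ 2 / 2) := by field_simp; ring
    _ ≤ _ := by
      gcongr
      have : 0 ≤ τ / 2 * |y| := by positivity
      linarith

lemma abs_mul_exp_le {τ σ : ℝ} (hτ : 0 < τ) (hσ : σ ≤ τ / 2) (y : ℝ) :
    |y| * Real.exp (σ * |y|) ≤ 2 / τ * Real.exp (τ * |y|) := by
  calc |y| * Real.exp (σ * |y|) ≤ (2 / τ * Real.exp (τ / 2 * |y|)) * Real.exp (τ / 2 * |y|) := by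
        gcongr; exact abs_le_exp hτ y
    _ = _ := by rw [mul_assoc, ← Real.exp_add]; ring_nf

lemma sq_mul_exp_le {τ σ : ℝ} (hτ : 0 < τ) (hσ : σ ≤ τ / 2) (y : ℝ) :
    |y| ^ 2 * Real.exp (σ * |y|) ≤ 8 / τ ^ 2 * Real.exp (τ * |y|) := by
  calc |y| ^ 2 * Real.exp (σ * |y|)
      ≤ (8 / τ ^ 2 * Real.exp (τ / 2 * |y|)) * Real.exp (τ / 2 * |y|) := by
        gcongr; exact sq_le_exp hτ y
    _ = _ := by rw [mul_assoc, ← Real.exp_add]; ring_nf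

namespace IsSmoothSplitting

variable {b : Bounds} {p ν : Measure ℝ} {f : ℝ → ℝ}

lemma right_le (h : IsSmoothSplitting b p ν f) : ν ≤ p := by
  rw [h.split]; exact Measure.le_add_left le_rfl

lemma left_le (h : IsSmoothSplitting b p ν f) :
    (volume.withDensity fun x => ENNReal.ofReal (f x)) ≤ p := by
  conv_rhs => rw [h.split]
  exact Measure.le_add_right le_rfl

lemma isFiniteMeasure_right (h : IsSmoothSplitting b p ν f) : IsFiniteMeasure ν :=
  have := h.prob
  isFiniteMeasure_of_le p h.right_le

lemma isFiniteMeasure_left (h : IsSmoothSplitting b p ν f) :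
    IsFiniteMeasure (volume.withDensity fun x => ENNReal.ofReal (f x)) :=
  have := h.prob
  isFiniteMeasure_of_le p h.left_le

lemma integrable_exp_abs (h : IsSmoothSplitting b p ν f) :
    Integrable (fun y => Real.exp (b.τ * |y|)) p := by
  refine ⟨by fun_prop, ?_⟩
  rw [HasFiniteIntegral]
  simpa only [Real.enorm_eq_ofReal (Real.exp_nonneg _), absTilt] using
    h.moment_le.trans_lt ENNReal.ofReal_lt_top

lemma integral_exp_abs_le (h : IsSmoothSplitting b p ν f) :
    ∫ y, Real.exp (b.τ * |y|) ∂p ≤ b.M := by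
  rw [integral_eq_lintegral_of_nonneg_ae (.of_forall fun _ => Real.exp_nonneg _) (by fun_prop)]
  exact ENNReal.toReal_le_of_le_ofReal b.M_pos.le h.moment_le

lemma integrable_id (h : IsSmoothSplitting b p ν f) : Integrable (fun y : ℝ => y) p := by
  refine (h.integrable_exp_abs.const_mul (2 / b.τ)).mono' (by fun_prop) (.of_forall fun y => ?_)
  have := abs_mul_exp_le b.τ_pos (σ := 0) (by linarith [b.τ_pos]) y
  simpa using this

lemma lintegral_tilt_lt_top (h : IsSmoothSplitting b p ν f) {ε : ℝ} (hε : |ε| ≤ b.τ) :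
    ∫⁻ y, tilt ε y ∂p < ∞ :=
  (lintegral_mono fun y => tilt_le_absTilt hε y).trans_lt
    (h.moment_le.trans_lt ENNReal.ofReal_lt_top)

/-- First order expansion of the transform at `0`. -/
lemma norm_one_sub_laplace_sub_le (h : IsSmoothSplitting b p ν f) {s : ℂ} (hs : ‖s‖ ≤ b.τ / 2) :
    ‖1 - laplace p s - s * mean p‖ ≤ ‖s‖ ^ 2 * (8 / b.τ ^ 2 * b.M) := by
  have := h.prob
  have hre : |s.re| ≤ b.τ := (Complex.abs_re_le_norm s).trans (by linarith [b.τ_pos])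
  have hi1 : Integrable (fun y : ℝ => Complex.exp (-s * y)) p :=
    integrable_cexp (h.lintegral_tilt_lt_top hre)
  have hi2 : Integrable (fun y : ℝ => s * (y : ℂ)) p := h.integrable_id.ofReal.const_mul s
  have heq : 1 - laplace p s - s * mean p = -∫ y : ℝ, (Complex.exp (-s * y) - 1 + s * y) ∂p := by
    have hi3 : Integrable (fun y : ℝ => Complex.exp (-s * y) - 1) p :=
      hi1.sub (integrable_const _)
    rw [integral_add hi3 hi2, integral_sub hi1 (integrable_const _),
      integral_const_mul, integral_complex_ofReal, laplace, mean]
    simp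
    ring
  rw [heq, norm_neg]
  calc _ ≤ ∫ y : ℝ, ‖s‖ ^ 2 * (8 / b.τ ^ 2 * Real.exp (b.τ * |y|)) ∂p := by
        refine norm_integral_le_of_norm_le ((h.integrable_exp_abs.const_mul _).const_mul _)
          (.of_forall fun y => ?_)
        have h2 := Complex.norm_exp_sub_sum_le_norm_mul_exp (-s * y) 2
        simp only [Finset.sum_range_succ, Finset.sum_range_zero] at h2
        have e1 : Complex.exp (-s * y) - 1 + s * y = Complex.exp (-s * y) -
            (0 + (-s * y) ^ 0 / (Nat.factorial 0 : ℂ) + (-s * y) ^ 1 / (Nat.factorial 1 : ℂ)) := by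
          simp; ring
        have e2 : ‖-s * (y : ℂ)‖ = ‖s‖ * |y| := by simp
        rw [e1]
        refine h2.trans ?_
        rw [e2, mul_pow, mul_assoc]
        exact mul_le_mul_of_nonneg_left (sq_mul_exp_le b.τ_pos hs y) (by positivity)
    _ ≤ _ := by
        rw [integral_const_mul, integral_const_mul]
        have := b.τ_pos
        gcongr
        exact h.integral_exp_abs_le

/-- The transform varies slowly in horizontal direction. -/
lemma norm_laplace_sub_le (h : IsSmoothSplitting b p ν f) {s : ℂ} (hs : |s.re| ≤ b.τ / 2) :
    ‖laplace p s - laplace p (s.im * Complex.I)‖ ≤ |s.re| * (2 / b.τ * b.M) := by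
  have := h.prob
  have hi1 : Integrable (fun y : ℝ => Complex.exp (-s * y)) p :=
    integrable_cexp (h.lintegral_tilt_lt_top (hs.trans (by linarith [b.τ_pos])))
  have hi2 : Integrable (fun y : ℝ => Complex.exp (-(s.im * Complex.I) * y)) p :=
    integrable_cexp (h.lintegral_tilt_lt_top (by simpa using b.τ_pos.le))
  rw [laplace, laplace, ← integral_sub hi1 hi2]
  calc _ ≤ ∫ y : ℝ, |s.re| * (2 / b.τ * Real.exp (b.τ * |y|)) ∂p := by
        refine norm_integral_le_of_norm_le ((h.integrable_exp_abs.const_mul _).const_mul _)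
          (.of_forall fun y => ?_)
        have h2 := Complex.norm_exp_sub_sum_le_norm_mul_exp (-(s.re : ℂ) * y) 1
        simp only [Finset.sum_range_succ, Finset.sum_range_zero] at h2
        have e1 : Complex.exp (-s * y) - Complex.exp (-(s.im * Complex.I) * y) =
            Complex.exp (-(s.im * Complex.I) * y) * (Complex.exp (-(s.re : ℂ) * y) -
            (0 + (-(s.re : ℂ) * y) ^ 0 / (Nat.factorial 0 : ℂ))) := by
          conv_lhs => rw [← Complex.re_add_im s]
          rw [show -((s.re : ℂ) + s.im * Complex.I) * y
            = -(s.im * Complex.I) * y + -(s.re : ℂ) * y by ring, Complex.exp_add]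
          simp; ring
        have e2 : ‖-(s.re : ℂ) * (y : ℂ)‖ = |s.re| * |y| := by simp
        rw [e1, norm_mul, norm_cexp_neg_mul]
        simp only [Complex.mul_re, Complex.ofReal_re, Complex.I_re, mul_zero, Complex.ofReal_im,
          Complex.I_im, mul_one, sub_self, zero_mul, neg_zero, Real.exp_zero, one_mul]
        refine h2.trans ?_
        rw [e2, pow_one, mul_assoc]
        exact mul_le_mul_of_nonneg_left (abs_mul_exp_le b.τ_pos hs y) (by positivity)
    _ ≤ _ := by
        rw [integral_const_mul, integral_const_mul]
        have := b.τ_pos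
        gcongr
        exact h.integral_exp_abs_le

end IsSmoothSplitting

/-- The radius of the disc around `0` in which `1 - p̂(s)` is compared with `s μ_p`. -/
noncomputable def Bounds.ρ (b : Bounds) : ℝ :=
  min (b.τ / 2) (b.m / (2 * (8 / b.τ ^ 2 * b.M)))

lemma Bounds.ρ_pos (b : Bounds) : 0 < b.ρ := by
  have h1 := b.τ_pos
  have h2 := b.m_pos
  have h3 := b.M_pos
  unfold Bounds.ρ; positivity

lemma Bounds.ρ_le (b : Bounds) : b.ρ ≤ b.τ / 2 := min_le_left _ _

lemma Bounds.ρ_mul_le (b : Bounds) : b.ρ * (8 / b.τ ^ 2 * b.M) ≤ b.m / 2 := by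
  have h1 := b.τ_pos
  have h3 := b.M_pos
  calc _ ≤ b.m / (2 * (8 / b.τ ^ 2 * b.M)) * (8 / b.τ ^ 2 * b.M) := by
        gcongr; exact min_le_right _ _
    _ = _ := by field_simp

namespace IsSmoothSplitting

variable {b : Bounds} {p ν : Measure ℝ} {f : ℝ → ℝ}

lemma norm_one_sub_laplace_ge_near (h : IsSmoothSplitting b p ν f) {s : ℂ} (hs : ‖s‖ ≤ b.ρ) :
    ‖s‖ * (b.m / 2) ≤ ‖1 - laplace p s‖ := by
  have h1 := h.norm_one_sub_laplace_sub_le (hs.trans b.ρ_le)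
  have h2 : ‖s‖ ^ 2 * (8 / b.τ ^ 2 * b.M) ≤ ‖s‖ * (b.m / 2) := by
    rw [pow_two, mul_assoc]
    gcongr
    have h1 := b.τ_pos
    have h3 := b.M_pos
    calc _ ≤ b.ρ * (8 / b.τ ^ 2 * b.M) := by gcongr
      _ ≤ _ := b.ρ_mul_le
  have h3 : ‖s‖ * b.m ≤ ‖s * mean p‖ := by
    rw [norm_mul, Complex.norm_real, Real.norm_eq_abs]
    gcongr
    exact h.mean_ge.trans (le_abs_self _)
  have h4 : ‖s * mean p‖ ≤ ‖1 - laplace p s‖ + ‖1 - laplace p s - s * mean p‖ := by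
    have := norm_sub_le (1 - laplace p s) (1 - laplace p s - s * mean p)
    simpa using this
  linarith

/-- Exponential tilting by a small `ε > 0` makes `p` defective. -/
lemma lintegral_tilt_le (h : IsSmoothSplitting b p ν f) {ε : ℝ} (h0 : 0 ≤ ε) (hε : ε ≤ b.ρ) :
    ∫⁻ y, tilt ε y ∂p ≤ ENNReal.ofReal (1 - ε * (b.m / 2)) := by
  have hn : ‖(ε : ℂ)‖ = ε := by simp [abs_of_nonneg h0]
  have h1 := h.norm_one_sub_laplace_sub_le (s := ε) (by rw [hn]; exact hε.trans b.ρ_le)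
  have hlt : ∫⁻ y, tilt ε y ∂p < ∞ := h.lintegral_tilt_lt_top (by
    rw [abs_of_nonneg h0]; linarith [b.ρ_le, b.τ_pos])
  have e : laplace p ε = ((∫⁻ y, tilt ε y ∂p).toReal : ℝ) := by
    rw [← integral_tilt, ← integral_complex_ofReal, laplace]
    congr 1 with y; push_cast; ring_nf
  rw [hn, e] at h1
  have h2 : |1 - (∫⁻ y, tilt ε y ∂p).toReal - ε * mean p| ≤ ε ^ 2 * (8 / b.τ ^ 2 * b.M) := by
    rw [← Real.norm_eq_abs, ← Complex.norm_real]; push_cast; exact h1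
  rw [← ENNReal.ofReal_toReal hlt.ne]
  refine ENNReal.ofReal_le_ofReal ?_
  have h3 := (abs_le.1 h2).1
  have h4 : ε ^ 2 * (8 / b.τ ^ 2 * b.M) ≤ ε * (b.m / 2) := by
    rw [pow_two, mul_assoc]
    gcongr
    have h1 := b.τ_pos
    have h3 := b.M_pos
    calc _ ≤ b.ρ * (8 / b.τ ^ 2 * b.M) := by gcongr
      _ ≤ _ := b.ρ_mul_le
  have h5 : ε * b.m ≤ ε * mean p := by gcongr; exact h.mean_ge
  linarith

lemma lintegral_tilt_lt_one (h : IsSmoothSplitting b p ν f) {ε : ℝ} (h0 : 0 < ε) (hε : ε ≤ b.ρ) :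
    ∫⁻ y, tilt ε y ∂p < 1 := by
  refine (h.lintegral_tilt_le h0.le hε).trans_lt ?_
  rw [ENNReal.ofReal_lt_one]
  have := mul_pos h0 b.m_pos
  linarith

/-- The part `ν` stays defective under small exponential weights. -/
lemma lintegral_absTilt_right_le (h : IsSmoothSplitting b p ν f) {σ : ℝ} (h0 : 0 ≤ σ)
    (hσ : σ ≤ b.τ / 2) (hσ' : σ * (2 / b.τ * b.M) ≤ b.δ / 2) :
    ∫⁻ y, absTilt σ y ∂ν ≤ ENNReal.ofReal (1 - b.δ / 2) := by
  have hδ := b.δ_le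
  have key : ∀ y, absTilt σ y ≤ 1 + ENNReal.ofReal (σ * (2 / b.τ)) * absTilt b.τ y := by
    intro y
    have hτ := b.τ_pos
    rw [absTilt, absTilt, ← ENNReal.ofReal_mul (by positivity), ← ENNReal.ofReal_one,
      ← ENNReal.ofReal_add zero_le_one (by positivity)]
    refine ENNReal.ofReal_le_ofReal ?_
    have h1 := abs_mul_exp_le hτ hσ y
    have h2 := Real.add_one_le_exp (-(σ * |y|))
    have h3 : Real.exp (σ * |y|) * Real.exp (-(σ * |y|)) = 1 := by
      rw [← Real.exp_add]; simp
    have h4 : Real.exp (σ * |y|) * (-(σ * |y|) + 1) ≤ 1 := by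
      exact (mul_le_mul_of_nonneg_left h2 (Real.exp_nonneg _)).trans h3.le
    have h5 : σ * (|y| * Real.exp (σ * |y|)) ≤ σ * (2 / b.τ * Real.exp (b.τ * |y|)) := by gcongr
    linarith
  calc _ ≤ ∫⁻ y, (1 + ENNReal.ofReal (σ * (2 / b.τ)) * absTilt b.τ y) ∂ν := lintegral_mono key
    _ = ν univ + ENNReal.ofReal (σ * (2 / b.τ)) * ∫⁻ y, absTilt b.τ y ∂ν := by
        rw [lintegral_add_left measurable_const, lintegral_const_mul _ (by fun_prop)]; simp
    _ ≤ ENNReal.ofReal (1 - b.δ) + ENNReal.ofReal (σ * (2 / b.τ)) * ENNReal.ofReal b.M := by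
        gcongr
        · exact h.mass_le
        · exact (lintegral_mono' h.right_le le_rfl).trans h.moment_le
    _ ≤ _ := by
        have hτ := b.τ_pos
        rw [← ENNReal.ofReal_mul (by positivity), ← ENNReal.ofReal_add (by linarith)
          (by have := b.M_pos; positivity)]
        refine ENNReal.ofReal_le_ofReal ?_
        linarith

end IsSmoothSplitting

/-! ### The smooth part -/

/-- One integration by parts in a Laplace transform. -/
lemma mul_integral_cexp {T : ℝ} {g g' : ℝ → ℝ} (hg : ∀ x, HasDerivAt g (g' x) x)
    (hg' : Continuous g') (h1 : g (-T) = 0) (h2 : g T = 0) (s : ℂ) :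
    s * ∫ x in (-T)..T, Complex.exp (-s * x) * g x =
      ∫ x in (-T)..T, Complex.exp (-s * x) * g' x := by
  have hu : ∀ x ∈ uIcc (-T) T, HasDerivAt (fun x : ℝ => (g x : ℂ)) (g' x : ℂ) x :=
    fun x _ => (hg x).ofReal_comp
  have hv : ∀ x ∈ uIcc (-T) T, HasDerivAt (fun x : ℝ => Complex.exp (-s * x))
      (Complex.exp (-s * x) * (-s)) x := by
    intro x _
    have := ((hasDerivAt_id (x : ℂ)).const_mul (-s)).cexp.comp_ofReal
    simpa using this
  have := intervalIntegral.integral_mul_deriv_eq_deriv_mul hu hv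
    ((by fun_prop : Continuous fun x => (g' x : ℂ)).intervalIntegrable _ _)
    ((by fun_prop : Continuous fun x : ℝ => Complex.exp (-s * x) * (-s)).intervalIntegrable _ _)
  rw [h1, h2] at this
  simp only [Complex.ofReal_zero, zero_mul, sub_self, zero_sub] at this
  have e : ∫ x in (-T)..T, (g x : ℂ) * (Complex.exp (-s * x) * (-s)) =
      -(s * ∫ x in (-T)..T, Complex.exp (-s * x) * g x) := by
    rw [← intervalIntegral.integral_const_mul, ← intervalIntegral.integral_neg]
    congr 1 with x; ring
  rw [e, neg_inj] at this
  rw [this]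
  congr 1 with x; ring

namespace IsSmoothSplitting

variable {b : Bounds} {p ν : Measure ℝ} {f : ℝ → ℝ}

lemma continuous (h : IsSmoothSplitting b p ν f) : Continuous f := h.contDiff.continuous

lemma hasDerivAt (h : IsSmoothSplitting b p ν f) (x : ℝ) : HasDerivAt f (deriv f x) x :=
  (h.contDiff.differentiable (by norm_num)).differentiableAt.hasDerivAt

lemma contDiff_deriv (h : IsSmoothSplitting b p ν f) : ContDiff ℝ 1 (deriv f) :=
  ((contDiff_succ_iff_deriv (n := 1)).1 h.contDiff).2.2

lemma hasDerivAt_deriv (h : IsSmoothSplitting b p ν f) (x : ℝ) :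
    HasDerivAt (deriv f) (iteratedDeriv 2 f x) x := by
  rw [iteratedDeriv_succ, iteratedDeriv_one]
  exact (h.contDiff_deriv.differentiable (by norm_num)).differentiableAt.hasDerivAt

lemma continuous_iteratedDeriv (h : IsSmoothSplitting b p ν f) :
    Continuous (iteratedDeriv 2 f) := h.contDiff.continuous_iteratedDeriv 2 le_rfl

lemma eq_zero (h : IsSmoothSplitting b p ν f) {x : ℝ} (hx : x ∉ Ioo (-b.T) b.T) : f x = 0 :=
  image_eq_zero_of_notMem_tsupport fun h' => hx (h.tsupport_subset h')

lemma deriv_eq_zero (h : IsSmoothSplitting b p ν f) {x : ℝ} (hx : x ∉ Ioo (-b.T) b.T) :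
    deriv f x = 0 := by
  have : x ∉ tsupport (deriv f) := fun h' => hx (h.tsupport_subset (tsupport_deriv_subset h'))
  exact image_eq_zero_of_notMem_tsupport this

lemma abs_deriv_le (h : IsSmoothSplitting b p ν f) (x : ℝ) : |deriv f x| ≤ b.B := by
  by_cases hx : x ∈ Ioo (-b.T) b.T
  · have h1 : ∫ y in (-b.T)..x, iteratedDeriv 2 f y = deriv f x := by
      rw [intervalIntegral.integral_eq_sub_of_hasDerivAt (fun y _ => h.hasDerivAt_deriv y)
        (h.continuous_iteratedDeriv.intervalIntegrable _ _), h.deriv_eq_zero (x := -b.T) (by simp),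
        sub_zero]
    rw [← h1]
    refine (intervalIntegral.abs_integral_le_integral_abs hx.1.le).trans
      (le_trans ?_ h.deriv_two_le)
    exact intervalIntegral.integral_mono_interval le_rfl hx.1.le hx.2.le
      (.of_forall fun _ => abs_nonneg _) (h.continuous_iteratedDeriv.abs.intervalIntegrable _ _)
  · rw [h.deriv_eq_zero hx, abs_zero]; exact b.B_pos.le

lemma le_bound (h : IsSmoothSplitting b p ν f) (x : ℝ) : f x ≤ 2 * b.T * b.B := by
  have hT := b.T_pos
  have hB := b.B_pos
  by_cases hx : x ∈ Ioo (-b.T) b.T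
  · have := Convex.norm_image_sub_le_of_norm_deriv_le (f := f) (C := b.B) (s := univ) (x := -b.T)
      (y := x) (fun y _ => (h.hasDerivAt y).differentiableAt) (fun y _ => h.abs_deriv_le y)
      convex_univ (mem_univ _) (mem_univ _)
    rw [h.eq_zero (x := -b.T) (by simp), sub_zero, Real.norm_eq_abs, Real.norm_eq_abs,
      sub_neg_eq_add, abs_of_pos (by linarith [hx.1] : 0 < x + b.T)] at this
    calc f x ≤ b.B * (x + b.T) := (le_abs_self _).trans this
      _ ≤ b.B * (b.T + b.T) := by gcongr; exact hx.2.le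
      _ = _ := by ring
  · rw [h.eq_zero hx]; positivity

lemma laplace_left (h : IsSmoothSplitting b p ν f) (s : ℂ) :
    laplace (volume.withDensity fun x => ENNReal.ofReal (f x)) s =
      ∫ x in (-b.T)..b.T, Complex.exp (-s * x) * f x := by
  have hT := b.T_pos
  rw [laplace, integral_withDensity_eq_integral_toReal_smul (h.continuous.measurable.ennreal_ofReal)
    (.of_forall fun _ => ENNReal.ofReal_lt_top), intervalIntegral.integral_of_le (by linarith)]
  rw [← integral_indicator measurableSet_Ioc]
  congr 1 with x
  rw [ENNReal.toReal_ofReal (h.nonneg x)]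
  by_cases hx : x ∈ Ioc (-b.T) b.T
  · rw [indicator_of_mem hx, Complex.real_smul, mul_comm]
  · rw [indicator_of_notMem hx, h.eq_zero fun h' => hx (Ioo_subset_Ioc_self h')]; simp

/-- The transform of the smooth part decays quadratically, by two integrations by parts. -/
lemma sq_mul_norm_laplace_left_le (h : IsSmoothSplitting b p ν f) (s : ℂ) :
    ‖s‖ ^ 2 * ‖laplace (volume.withDensity fun x => ENNReal.ofReal (f x)) s‖ ≤
      Real.exp (|s.re| * b.T) * b.B := by
  have hT := b.T_pos
  rw [h.laplace_left, ← norm_pow, ← norm_mul, pow_two, mul_assoc,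
    mul_integral_cexp h.hasDerivAt h.contDiff_deriv.continuous (h.eq_zero (by simp))
      (h.eq_zero (by simp)),
    mul_integral_cexp h.hasDerivAt_deriv h.continuous_iteratedDeriv (h.deriv_eq_zero (by simp))
      (h.deriv_eq_zero (by simp))]
  calc _ ≤ ∫ x in (-b.T)..b.T, Real.exp (|s.re| * b.T) * |iteratedDeriv 2 f x| := by
        refine intervalIntegral.norm_integral_le_of_norm_le (by linarith)
          (.of_forall fun x hx => ?_)
          ((continuous_const.mul h.continuous_iteratedDeriv.abs).intervalIntegrable _ _)
        rw [norm_mul, norm_cexp_neg_mul, Complex.norm_real, Real.norm_eq_abs]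
        gcongr
        calc -(s.re * x) ≤ |s.re * x| := neg_le_abs _
          _ = |s.re| * |x| := abs_mul _ _
          _ ≤ _ := by gcongr; exact abs_le.2 ⟨hx.1.le, hx.2⟩
    _ ≤ _ := by
        rw [intervalIntegral.integral_const_mul]
        gcongr
        exact h.deriv_two_le

lemma norm_laplace_left_le (h : IsSmoothSplitting b p ν f) {s : ℂ} (hs : |s.re| ≤ b.τ) :
    ‖laplace (volume.withDensity fun x => ENNReal.ofReal (f x)) s‖ ≤ b.M := by
  refine norm_laplace_le.trans (ENNReal.toReal_le_of_le_ofReal b.M_pos.le ?_)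
  refine (lintegral_mono' h.left_le fun y => ?_).trans h.moment_le
  exact tilt_le_absTilt hs y

/-! ### A lower bound for `1 - p̂` -/

/-- On the imaginary axis, the real part of `1 - p̂` is bounded below by the contribution of the
smooth part of `p`. -/
lemma re_one_sub_laplace_ge (h : IsSmoothSplitting b p ν f) (θ : ℝ) :
    ∫ y, (1 - Real.cos (θ * y)) ∂(volume.withDensity fun x => ENNReal.ofReal (f x)) ≤
      (1 - laplace p (θ * Complex.I)).re := by
  have := h.prob
  have hi : Integrable (fun y : ℝ => Complex.exp (-(θ * Complex.I) * y)) p :=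
    integrable_cexp (h.lintegral_tilt_lt_top (by simpa using b.τ_pos.le))
  have hc : Integrable (fun y : ℝ => 1 - Real.cos (θ * y)) p :=
    (integrable_const (2 : ℝ)).mono' (by fun_prop) (.of_forall fun y => by
      rw [Real.norm_eq_abs, abs_of_nonneg (by linarith [Real.cos_le_one (θ * y)])]
      linarith [Real.neg_one_le_cos (θ * y)])
  have e : (1 - laplace p (θ * Complex.I)).re = ∫ y, (1 - Real.cos (θ * y)) ∂p := by
    have : (1 : ℂ) - laplace p (θ * Complex.I) =
        ∫ y : ℝ, (1 - Complex.exp (-(θ * Complex.I) * y)) ∂p := by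
      rw [integral_sub (integrable_const _) hi, laplace]; simp
    have hi' : Integrable (fun y : ℝ => 1 - Complex.exp (-(θ * Complex.I) * y)) p :=
      (integrable_const _).sub hi
    rw [this, ← RCLike.re_eq_complex_re, ← integral_re hi']
    congr 1 with y
    simp [Complex.exp_re]
  rw [e]
  exact integral_mono_measure h.left_le
    (.of_forall fun y => by simpa using Real.cos_le_one (θ * y)) hc

lemma integral_one_sub_cos_two_mul_le (h : IsSmoothSplitting b p ν f) (θ : ℝ) :
    ∫ y, (1 - Real.cos (2 * θ * y)) ∂(volume.withDensity fun x => ENNReal.ofReal (f x)) ≤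
      4 * ∫ y, (1 - Real.cos (θ * y)) ∂(volume.withDensity fun x => ENNReal.ofReal (f x)) := by
  have := h.isFiniteMeasure_left
  have hc : ∀ θ : ℝ, Integrable (fun y : ℝ => 1 - Real.cos (θ * y))
      (volume.withDensity fun x => ENNReal.ofReal (f x)) := fun θ =>
    (integrable_const (2 : ℝ)).mono' (by fun_prop) (.of_forall fun y => by
      rw [Real.norm_eq_abs, abs_of_nonneg (by linarith [Real.cos_le_one (θ * y)])]
      linarith [Real.neg_one_le_cos (θ * y)])
  rw [← integral_const_mul]
  refine integral_mono (hc _) ((hc _).const_mul 4) fun y => ?_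
  simp only
  rw [mul_assoc, Real.cos_two_mul]
  nlinarith [Real.cos_le_one (θ * y), Real.neg_one_le_cos (θ * y)]

/-- Halving the frequency loses at most a factor `4`. Iteration carries a lower bound at high
frequencies down to low ones. -/
lemma integral_one_sub_cos_two_pow_mul_le (h : IsSmoothSplitting b p ν f) (θ : ℝ) (n : ℕ) :
    ∫ y, (1 - Real.cos (2 ^ n * θ * y)) ∂(volume.withDensity fun x => ENNReal.ofReal (f x)) ≤
      4 ^ n * ∫ y, (1 - Real.cos (θ * y)) ∂(volume.withDensity fun x => ENNReal.ofReal (f x)) := by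
  induction n with
  | zero => simp
  | succ n ih =>
    have := h.integral_one_sub_cos_two_mul_le (2 ^ n * θ)
    rw [pow_succ', pow_succ', mul_assoc 2, mul_assoc 4]
    exact this.trans (by gcongr)

lemma delta_le_left (h : IsSmoothSplitting b p ν f) :
    b.δ ≤ (volume.withDensity fun x => ENNReal.ofReal (f x)).real univ := by
  have := h.prob
  have := h.isFiniteMeasure_left
  have := h.isFiniteMeasure_right
  have h1 : (volume.withDensity fun x => ENNReal.ofReal (f x)).real univ + ν.real univ = 1 := by
    rw [← measureReal_add_apply, ← h.split]; simp
  have h2 : ν.real univ ≤ 1 - b.δ :=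
    ENNReal.toReal_le_of_le_ofReal (by linarith [b.δ_le]) h.mass_le
  linarith

/-- The lower bound at high frequencies. -/
lemma integral_one_sub_cos_ge (h : IsSmoothSplitting b p ν f) {θ : ℝ}
    (hθ : 2 * b.B / b.δ ≤ θ ^ 2) :
    b.δ / 2 ≤ ∫ y, (1 - Real.cos (θ * y)) ∂(volume.withDensity fun x => ENNReal.ofReal (f x)) := by
  have := h.isFiniteMeasure_left
  have hB := b.B_pos
  have hδ := b.δ_pos
  set β := volume.withDensity fun x => ENNReal.ofReal (f x)
  have hc : Integrable (fun y : ℝ => Real.cos (θ * y)) β :=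
    (integrable_const (1 : ℝ)).mono' (by fun_prop) (.of_forall fun y => Real.abs_cos_le_one _)
  have hi : Integrable (fun y : ℝ => Complex.exp (-(θ * Complex.I) * y)) β :=
    integrable_cexp ((lintegral_mono' h.left_le le_rfl).trans_lt
      (h.lintegral_tilt_lt_top (by simpa using b.τ_pos.le)))
  have h1 : ∫ y, Real.cos (θ * y) ∂β ≤ ‖laplace β (θ * Complex.I)‖ := by
    refine le_trans (le_of_eq ?_) (Complex.re_le_norm _)
    rw [laplace, ← RCLike.re_eq_complex_re, ← integral_re hi]
    congr 1 with y
    simp [Complex.exp_re]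
  have h2 := h.sq_mul_norm_laplace_left_le (θ * Complex.I)
  have h3 : ‖(θ : ℂ) * Complex.I‖ ^ 2 = θ ^ 2 := by simp
  rw [h3] at h2
  simp only [Complex.mul_re, Complex.ofReal_re, Complex.I_re, mul_zero, Complex.ofReal_im,
          Complex.I_im, mul_one, sub_self, abs_zero, zero_mul, Real.exp_zero, one_mul] at h2
  have h4 : ‖laplace β (θ * Complex.I)‖ ≤ b.δ / 2 := by
    have h5 : 0 < 2 * b.B / b.δ := by positivity
    refine le_of_mul_le_mul_left ?_ h5
    calc _ ≤ θ ^ 2 * ‖laplace β (θ * Complex.I)‖ := by gcongr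
      _ ≤ b.B := h2
      _ = _ := by field_simp
  rw [integral_sub (integrable_const _) hc]
  have h6 := h.delta_le_left
  simp only [integral_const, smul_eq_mul, mul_one]
  linarith

end IsSmoothSplitting

/-- On a vertical strip, `1 - p̂` is bounded away from its zero at the origin, uniformly in `p`. -/
lemma exists_spectral_gap (b : Bounds) : ∃ r > 0, ∃ c > 0, r ≤ b.ρ ∧
    ∀ (p ν : Measure ℝ) (f : ℝ → ℝ), IsSmoothSplitting b p ν f →
      ∀ s : ℂ, |s.re| ≤ r → c * min ‖s‖ 1 ≤ ‖1 - laplace p s‖ := by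
  have hρ := b.ρ_pos
  have hB := b.B_pos
  have hδ := b.δ_pos
  have hm := b.m_pos
  have hM := b.M_pos
  have hτ := b.τ_pos
  obtain ⟨n, hn⟩ := pow_unbounded_of_one_lt ((2 * b.B / b.δ) / (b.ρ / 2) ^ 2)
    (by norm_num : (1 : ℝ) < 4)
  set c₀ : ℝ := b.δ / 2 / 4 ^ n with hc₀
  have hc₀p : 0 < c₀ := by positivity
  refine ⟨min (b.ρ / 2) (c₀ / 2 / (2 / b.τ * b.M)), by positivity, min (b.m / 2) (c₀ / 2),
    by positivity, (min_le_left _ _).trans (by linarith), fun p ν f h s hs => ?_⟩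
  have hs1 := hs.trans (min_le_left _ _)
  have hs2 := hs.trans (min_le_right _ _)
  by_cases him : |s.im| ≤ b.ρ / 2
  · have hns : ‖s‖ ≤ b.ρ := (Complex.norm_le_abs_re_add_abs_im s).trans (by linarith)
    refine le_trans ?_ (h.norm_one_sub_laplace_ge_near hns)
    rw [mul_comm]
    gcongr
    · exact min_le_left _ _
    · exact min_le_left _ _
  · push Not at him
    have h1 : c₀ ≤ ‖1 - laplace p (s.im * Complex.I)‖ := by
      refine le_trans ?_ (Complex.re_le_norm _)
      refine le_trans ?_ (h.re_one_sub_laplace_ge s.im)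
      rw [hc₀, div_le_iff₀' (by positivity)]
      refine le_trans ?_ (h.integral_one_sub_cos_two_pow_mul_le s.im n)
      refine h.integral_one_sub_cos_ge ?_
      rw [div_lt_iff₀ (by positivity)] at hn
      refine hn.le.trans ?_
      rw [mul_pow, ← pow_mul, mul_comm n 2, pow_mul, ← sq_abs s.im]
      norm_num only
      gcongr
    have h2 : ‖laplace p s - laplace p (s.im * Complex.I)‖ ≤ c₀ / 2 := by
      refine (h.norm_laplace_sub_le (by linarith [b.ρ_le])).trans ?_
      rwa [← le_div_iff₀ (by positivity)]
    have h3 : ‖1 - laplace p (s.im * Complex.I)‖ ≤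
        ‖1 - laplace p s‖ + ‖laplace p s - laplace p (s.im * Complex.I)‖ := by
      have := norm_add_le (1 - laplace p s) (laplace p s - laplace p (s.im * Complex.I))
      simpa using this
    calc _ ≤ c₀ / 2 * 1 := by
          gcongr
          · exact min_le_right _ _
          · exact min_le_right _ _
      _ ≤ _ := by linarith

/-! ### The density of the renewal measure -/

/-- The measure `N̄_p * N_p`, against which the smooth part is convolved. -/
noncomputable def kernelMeasure (p ν : Measure ℝ) : Measure ℝ :=
  (renewalMeasure ν).conv (renewalMeasure p)

/-- The density `q_p` of the absolutely continuous part of the renewal measure. -/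
noncomputable def density (p ν : Measure ℝ) (f : ℝ → ℝ) (x : ℝ) : ℝ :=
  ∫ y, f (x - y) ∂(kernelMeasure p ν)

/-- A bound for the tilted mass of the renewal measures of `p` and of its parts. -/
noncomputable def Bounds.K (b : Bounds) (ε : ℝ) : ℝ≥0∞ :=
  (1 - ENNReal.ofReal (1 - ε * (b.m / 2)))⁻¹

lemma Bounds.K_lt_top (b : Bounds) {ε : ℝ} (hε : 0 < ε) : b.K ε < ∞ := by
  have h : ENNReal.ofReal (1 - ε * (b.m / 2)) < 1 := by
    rw [ENNReal.ofReal_lt_one]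
    have := mul_pos hε b.m_pos
    linarith
  rw [Bounds.K, ENNReal.inv_lt_top]
  exact tsub_pos_of_lt h

namespace IsSmoothSplitting

variable {b : Bounds} {p ν : Measure ℝ} {f : ℝ → ℝ}

lemma sFinite_kernelMeasure (h : IsSmoothSplitting b p ν f) : SFinite (kernelMeasure p ν) := by
  have := h.prob
  have := h.isFiniteMeasure_right
  unfold kernelMeasure; infer_instance

lemma lintegral_tilt_right_le (h : IsSmoothSplitting b p ν f) {ε : ℝ} :
    ∫⁻ y, tilt ε y ∂ν ≤ ∫⁻ y, tilt ε y ∂p :=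
  lintegral_mono' h.right_le le_rfl

lemma lintegral_tilt_renewalMeasure_le (h : IsSmoothSplitting b p ν f) {ε : ℝ} (h0 : 0 ≤ ε)
    (hε : ε ≤ b.ρ) : ∫⁻ y, tilt ε y ∂(renewalMeasure p) ≤ b.K ε := by
  have := h.prob
  refine (UniformRenewal.lintegral_tilt_renewalMeasure_le p ε).trans ?_
  unfold Bounds.K
  gcongr
  exact h.lintegral_tilt_le h0 hε

lemma lintegral_tilt_renewalMeasure_right_le (h : IsSmoothSplitting b p ν f) {ε : ℝ} (h0 : 0 ≤ ε)
    (hε : ε ≤ b.ρ) : ∫⁻ y, tilt ε y ∂(renewalMeasure ν) ≤ b.K ε := by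
  have := h.isFiniteMeasure_right
  refine (UniformRenewal.lintegral_tilt_renewalMeasure_le ν ε).trans ?_
  unfold Bounds.K
  gcongr
  exact h.lintegral_tilt_right_le.trans (h.lintegral_tilt_le h0 hε)

lemma lintegral_tilt_kernelMeasure_le (h : IsSmoothSplitting b p ν f) {ε : ℝ} (h0 : 0 ≤ ε)
    (hε : ε ≤ b.ρ) : ∫⁻ y, tilt ε y ∂(kernelMeasure p ν) ≤ b.K ε * b.K ε := by
  have := h.prob
  refine (lintegral_conv_le (measurable_tilt _) (fun x y => (tilt_add ε x y).le) _ _).trans ?_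
  gcongr
  · exact h.lintegral_tilt_renewalMeasure_right_le h0 hε
  · exact h.lintegral_tilt_renewalMeasure_le h0 hε

lemma lintegral_tilt_kernelMeasure_lt_top (h : IsSmoothSplitting b p ν f) {ε : ℝ} (h0 : 0 < ε)
    (hε : ε ≤ b.ρ) : ∫⁻ y, tilt ε y ∂(kernelMeasure p ν) < ∞ :=
  (h.lintegral_tilt_kernelMeasure_le h0.le hε).trans_lt
    (ENNReal.mul_lt_top (b.K_lt_top h0) (b.K_lt_top h0))

lemma apply_sub_le (h : IsSmoothSplitting b p ν f) {ε : ℝ} (h0 : 0 ≤ ε) (x y : ℝ) :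
    f (x - y) ≤ 2 * b.T * b.B * Real.exp (ε * (x + b.T)) * Real.exp (-(ε * y)) := by
  have hT := b.T_pos
  have hB := b.B_pos
  by_cases hx : x - y ∈ Ioo (-b.T) b.T
  · rw [mul_assoc, ← Real.exp_add]
    refine (h.le_bound _).trans (le_mul_of_one_le_right (by positivity) (Real.one_le_exp ?_))
    have := mul_nonneg h0 (by linarith [hx.1] : 0 ≤ x + b.T - y)
    linarith
  · rw [h.eq_zero hx]; positivity

lemma integrable_apply_sub (h : IsSmoothSplitting b p ν f) (x : ℝ) :
    Integrable (fun y => f (x - y)) (kernelMeasure p ν) := by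
  have hc := h.continuous
  refine ((integrable_tilt (h.lintegral_tilt_kernelMeasure_lt_top b.ρ_pos le_rfl)).const_mul
    (2 * b.T * b.B * Real.exp (b.ρ * (x + b.T)))).mono' (by fun_prop) (.of_forall fun y => ?_)
  rw [Real.norm_eq_abs, abs_of_nonneg (h.nonneg _)]
  exact h.apply_sub_le b.ρ_pos.le x y

lemma density_nonneg (h : IsSmoothSplitting b p ν f) (x : ℝ) : 0 ≤ density p ν f x :=
  integral_nonneg fun _ => h.nonneg _

lemma density_le (h : IsSmoothSplitting b p ν f) {ε : ℝ} (h0 : 0 < ε) (hε : ε ≤ b.ρ) (x : ℝ) :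
    density p ν f x ≤ 2 * b.T * b.B * Real.exp (ε * (x + b.T)) * (b.K ε * b.K ε).toReal := by
  have hT := b.T_pos
  have hB := b.B_pos
  calc density p ν f x
      ≤ ∫ y, 2 * b.T * b.B * Real.exp (ε * (x + b.T)) * Real.exp (-(ε * y))
          ∂(kernelMeasure p ν) :=
        integral_mono (h.integrable_apply_sub x)
          ((integrable_tilt (h.lintegral_tilt_kernelMeasure_lt_top h0 hε)).const_mul _)
          (h.apply_sub_le h0.le x)
    _ ≤ _ := by
        rw [integral_const_mul, integral_tilt]
        gcongr
        · exact ENNReal.mul_ne_top (b.K_lt_top h0).ne (b.K_lt_top h0).ne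
        · exact h.lintegral_tilt_kernelMeasure_le h0.le hε

lemma continuous_density (h : IsSmoothSplitting b p ν f) : Continuous (density p ν f) := by
  have hc := h.continuous
  have hT := b.T_pos
  have hB := b.B_pos
  have hρ := b.ρ_pos
  refine continuous_iff_continuousAt.2 fun x₀ => ?_
  refine continuousAt_of_dominated (bound := fun y =>
    2 * b.T * b.B * Real.exp (b.ρ * (x₀ + 1 + b.T)) * Real.exp (-(b.ρ * y)))
    (.of_forall fun x => by fun_prop) ?_
    ((integrable_tilt (h.lintegral_tilt_kernelMeasure_lt_top b.ρ_pos le_rfl)).const_mul _)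
    (.of_forall fun y => by fun_prop)
  filter_upwards [Iio_mem_nhds (lt_add_one x₀)] with x hx
  refine .of_forall fun y => ?_
  rw [Real.norm_eq_abs, abs_of_nonneg (h.nonneg _)]
  refine (h.apply_sub_le hρ.le x y).trans ?_
  have : x ≤ x₀ + 1 := le_of_lt hx
  gcongr

lemma ofReal_density (h : IsSmoothSplitting b p ν f) (x : ℝ) :
    ENNReal.ofReal (density p ν f x) = ∫⁻ y, ENNReal.ofReal (f (x - y)) ∂(kernelMeasure p ν) :=
  ofReal_integral_eq_lintegral_ofReal (h.integrable_apply_sub x)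
    (.of_forall fun _ => h.nonneg _)

/-- The renewal measure is the sum of a part with density `q_p` and of the renewal measure of the
singular part. -/
lemma renewalMeasure_eq_add (h : IsSmoothSplitting b p ν f) :
    renewalMeasure p =
      (volume.withDensity fun x => ENNReal.ofReal (density p ν f x)) + renewalMeasure ν := by
  have := h.prob
  have := h.isFiniteMeasure_right
  have := h.isFiniteMeasure_left
  have := h.sFinite_kernelMeasure
  rw [renewalMeasure_splitting h.split (h.lintegral_tilt_lt_one b.ρ_pos le_rfl),
    ← kernelMeasure, withDensity_conv h.continuous.measurable.ennreal_ofReal]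
  simp only [h.ofReal_density]

lemma lintegral_tilt_density_lt_top (h : IsSmoothSplitting b p ν f) {ε : ℝ} (h0 : 0 < ε)
    (hε : ε ≤ b.ρ) :
    ∫⁻ y, tilt ε y ∂(volume.withDensity fun x => ENNReal.ofReal (density p ν f x)) < ∞ := by
  refine (lintegral_mono' ?_ le_rfl).trans_lt
    ((h.lintegral_tilt_renewalMeasure_le h0.le hε).trans_lt (b.K_lt_top h0))
  conv_rhs => rw [h.renewalMeasure_eq_add]
  exact Measure.le_add_right le_rfl

/-- The Laplace transform of `q_p`, to the right of the imaginary axis. -/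
lemma laplace_density_mul (h : IsSmoothSplitting b p ν f) {s : ℂ} (h0 : 0 < s.re)
    (hs : s.re ≤ b.ρ) :
    laplace (volume.withDensity fun x => ENNReal.ofReal (density p ν f x)) s *
      ((1 - laplace ν s) * (1 - laplace p s)) =
      laplace (volume.withDensity fun x => ENNReal.ofReal (f x)) s := by
  have := h.prob
  have := h.isFiniteMeasure_right
  have hp1 := h.lintegral_tilt_lt_one h0 hs
  have hν1 := h.lintegral_tilt_right_le.trans_lt hp1
  have hβ1 := (lintegral_mono' h.left_le (le_refl (tilt s.re))).trans_lt hp1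
  have e1 := laplace_renewalMeasure_mul hp1
  have e2 := laplace_renewalMeasure_mul hν1
  have e3 : laplace (renewalMeasure p) s = laplace (volume.withDensity fun x =>
      ENNReal.ofReal (density p ν f x)) s + laplace (renewalMeasure ν) s := by
    conv_lhs => rw [h.renewalMeasure_eq_add]
    exact laplace_add (h.lintegral_tilt_density_lt_top h0 hs)
      (lintegral_tilt_renewalMeasure_lt_top hν1)
  have e4 : laplace p s = laplace (volume.withDensity fun x => ENNReal.ofReal (f x)) s +
      laplace ν s := by
    conv_lhs => rw [h.split]
    exact laplace_add (hβ1.trans ENNReal.one_lt_top) (hν1.trans ENNReal.one_lt_top)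
  linear_combination (-(1 - laplace ν s) * (1 - laplace p s)) * e3 + (1 - laplace ν s) * e1
    - (1 - laplace p s) * e2 + e4

lemma laplace_density (h : IsSmoothSplitting b p ν f) (s : ℂ) :
    laplace (volume.withDensity fun x => ENNReal.ofReal (density p ν f x)) s =
      ∫ x : ℝ, Complex.exp (-s * x) * density p ν f x := by
  rw [laplace, integral_withDensity_eq_integral_toReal_smul
    (h.continuous_density.measurable.ennreal_ofReal) (.of_forall fun _ => ENNReal.ofReal_lt_top)]
  congr 1 with x
  rw [ENNReal.toReal_ofReal (h.density_nonneg x), Complex.real_smul, mul_comm]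

lemma integrable_cexp_mul_density (h : IsSmoothSplitting b p ν f) {s : ℂ} (h0 : 0 < s.re)
    (hs : s.re ≤ b.ρ) : Integrable fun x : ℝ => Complex.exp (-s * x) * density p ν f x := by
  have h1 := integrable_cexp (h.lintegral_tilt_density_lt_top h0 hs)
  rw [integrable_withDensity_iff_integrable_smul'
    (h.continuous_density.measurable.ennreal_ofReal)
    (.of_forall fun _ => ENNReal.ofReal_lt_top)] at h1
  refine h1.congr (.of_forall fun x => ?_)
  simp only
  rw [ENNReal.toReal_ofReal (h.density_nonneg x), Complex.real_smul, mul_comm]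

end IsSmoothSplitting

/-! ### Contour shift -/

/-- The function `1 - exp (-x)` on `(0, ∞)`, extended by zero. Its Laplace transform
`1 / (s (s + 1))` has the pole of `1 / s` at `0`, but is integrable on vertical lines. -/
noncomputable def oneSubExp (x : ℝ) : ℝ := (Ioi (0 : ℝ)).indicator (fun x => 1 - Real.exp (-x)) x

lemma integrable_cexp_mul_oneSubExp {s : ℂ} (h0 : 0 < s.re) :
    Integrable fun x : ℝ => Complex.exp (-s * x) * oneSubExp x := by
  have h1 : IntegrableOn (fun x : ℝ => Complex.exp (-s * x) - Complex.exp ((-s - 1) * x))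
      (Ioi 0) :=
    (integrableOn_exp_mul_complex_Ioi (by simpa using h0) 0).sub
      (integrableOn_exp_mul_complex_Ioi (by simp; linarith) 0)
  refine (h1.integrable_indicator measurableSet_Ioi).congr (.of_forall fun x => ?_)
  by_cases hx : x ∈ Ioi (0 : ℝ)
  · simp only [oneSubExp, indicator_of_mem hx]
    rw [sub_mul (-s), Complex.exp_sub]
    push_cast
    rw [Complex.exp_neg, one_mul]
    field_simp
  · simp [oneSubExp, indicator_of_notMem hx]

lemma integral_cexp_mul_oneSubExp {s : ℂ} (h0 : 0 < s.re) :
    ∫ x : ℝ, Complex.exp (-s * x) * oneSubExp x = 1 / (s * (s + 1)) := by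
  have hs : s ≠ 0 := by rintro rfl; simp at h0
  have hs1 : s + 1 ≠ 0 := by
    intro h
    have := congrArg Complex.re h
    simp at this
    linarith
  have e : ∫ x : ℝ, Complex.exp (-s * x) * oneSubExp x =
      ∫ x in Ioi (0 : ℝ), (Complex.exp (-s * x) - Complex.exp ((-s - 1) * x)) := by
    rw [← integral_indicator measurableSet_Ioi]
    congr 1 with x
    by_cases hx : x ∈ Ioi (0 : ℝ)
    · simp only [oneSubExp, indicator_of_mem hx]
      rw [sub_mul (-s), Complex.exp_sub]
      push_cast
      rw [Complex.exp_neg, one_mul]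
      field_simp
    · simp [oneSubExp, indicator_of_notMem hx]
  rw [e, integral_sub (integrableOn_exp_mul_complex_Ioi (by simpa using h0) 0)
      (integrableOn_exp_mul_complex_Ioi (by simp; linarith) 0),
    integral_exp_mul_complex_Ioi (by simpa using h0),
    integral_exp_mul_complex_Ioi (by simp; linarith)]
  have hs2 : -s - 1 ≠ 0 := by
    intro h; apply hs1; linear_combination -h
  simp only [Complex.ofReal_zero, mul_zero, Complex.exp_zero]
  field_simp
  ring

/-- The integrals of a holomorphic function over two vertical lines agree if it decays
quadratically in the strip between them. -/
lemma integral_vertical_eq {G : ℂ → ℂ} {a c C : ℝ} (hac : a ≤ c)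
    (hd : ∀ s : ℂ, a ≤ s.re → s.re ≤ c → DifferentiableAt ℂ G s)
    (hb : ∀ s : ℂ, a ≤ s.re → s.re ≤ c → 1 ≤ |s.im| → ‖G s‖ ≤ C / (1 + s.im ^ 2))
    (ha : Integrable fun θ : ℝ => G (a + θ * Complex.I))
    (hc : Integrable fun θ : ℝ => G (c + θ * Complex.I)) :
    ∫ θ : ℝ, G (a + θ * Complex.I) = ∫ θ : ℝ, G (c + θ * Complex.I) := by
  have key : ∀ R : ℝ, 1 ≤ R →
      ‖(∫ θ in (-R)..R, G (c + θ * Complex.I)) - ∫ θ in (-R)..R, G (a + θ * Complex.I)‖ ≤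
        2 * (C / (1 + R ^ 2) * (c - a)) := by
    intro R hR
    have h1 := Complex.integral_boundary_rect_eq_zero_of_differentiableOn G
      (a + (-R : ℝ) * Complex.I) (c + R * Complex.I) (by
        intro s hs
        obtain ⟨h2, h3⟩ := hs
        simp only [Complex.add_re, Complex.ofReal_re, Complex.mul_re, Complex.I_re, mul_zero,
          Complex.ofReal_im, Complex.I_im, mul_one, sub_self, add_zero, mem_preimage,
          uIcc_of_le hac] at h2
        exact (hd s h2.1 h2.2).differentiableWithinAt)
    simp only [Complex.add_re, Complex.ofReal_re, Complex.mul_re, Complex.I_re, mul_zero,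
      Complex.ofReal_im, Complex.I_im, mul_one, sub_self, add_zero, Complex.add_im,
      Complex.mul_im, zero_add] at h1
    have hn : ∀ r : ℝ, |r| = R →
        ‖∫ x in a..c, G (x + r * Complex.I)‖ ≤ C / (1 + R ^ 2) * (c - a) := by
      intro r hr
      have := intervalIntegral.norm_integral_le_of_norm_le_const (a := a) (b := c)
        (f := fun x : ℝ => G (x + r * Complex.I)) (C := C / (1 + R ^ 2)) (by
          intro x hx
          rw [uIoc_of_le hac] at hx
          have := hb (x + r * Complex.I) (by simpa using hx.1.le) (by simpa using hx.2)
            (by simpa [hr] using hR)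
          simpa [← sq_abs r, hr] using this)
      rwa [abs_of_nonneg (sub_nonneg.2 hac)] at this
    have e : ‖(∫ θ in (-R)..R, G (c + θ * Complex.I)) - ∫ θ in (-R)..R, G (a + θ * Complex.I)‖ =
        ‖(∫ x in a..c, G (x + R * Complex.I)) - ∫ x in a..c, G (x + (-R : ℝ) * Complex.I)‖ := by
      rw [← one_mul ‖(∫ θ in (-R)..R, G (c + θ * Complex.I)) - _‖, ← Complex.norm_I, ← norm_mul]
      congr 1
      rw [smul_eq_mul, smul_eq_mul] at h1
      linear_combination h1
    rw [e]
    refine (norm_sub_le _ _).trans ?_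
    have h3 := hn R (abs_of_nonneg (by linarith))
    have h4 := hn (-R) (by rw [abs_neg, abs_of_nonneg (by linarith)])
    linarith
  have l1 := (intervalIntegral_tendsto_integral hc tendsto_neg_atTop_atBot tendsto_id).sub
    (intervalIntegral_tendsto_integral ha tendsto_neg_atTop_atBot tendsto_id)
  have l2 : Tendsto (fun R : ℝ => 2 * (C / (1 + R ^ 2) * (c - a))) atTop (𝓝 0) := by
    have : Tendsto (fun R : ℝ => C / (1 + R ^ 2)) atTop (𝓝 0) :=
      tendsto_const_nhds.div_atTop (tendsto_atTop_add_const_left _ _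
        (tendsto_pow_atTop two_ne_zero))
    simpa using (this.mul_const (c - a)).const_mul 2
  have l3 := squeeze_zero_norm' (Filter.eventually_atTop.2 ⟨1, key⟩) l2
  exact (sub_eq_zero.1 (tendsto_nhds_unique l1 l3)).symm

/-! ### Exponential decay of the density -/

namespace IsSmoothSplitting

variable {b : Bounds} {p ν : Measure ℝ} {f : ℝ → ℝ}

lemma lintegral_tilt_lt_top_of_le (h : IsSmoothSplitting b p ν f) {μ : Measure ℝ} (hμ : μ ≤ p)
    {ε : ℝ} (hε : |ε| ≤ b.τ) : ∫⁻ y, tilt ε y ∂μ < ∞ :=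
  (lintegral_mono' hμ le_rfl).trans_lt (h.lintegral_tilt_lt_top hε)

lemma mem_interior_integrableExpSet (h : IsSmoothSplitting b p ν f) {μ : Measure ℝ} (hμ : μ ≤ p)
    {t : ℝ} (ht : |t| < b.τ) : t ∈ interior (ProbabilityTheory.integrableExpSet id μ) := by
  refine mem_interior.2 ⟨Ioo (-b.τ) b.τ, fun u hu => ?_, isOpen_Ioo, abs_lt.1 ht⟩
  have := integrable_tilt (h.lintegral_tilt_lt_top_of_le hμ (ε := -u)
    (by rw [abs_neg]; exact (abs_lt.2 hu).le))
  simpa [ProbabilityTheory.integrableExpSet] using this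

lemma hasDerivAt_laplace (h : IsSmoothSplitting b p ν f) {μ : Measure ℝ} (hμ : μ ≤ p) {s : ℂ}
    (hs : |s.re| < b.τ) :
    HasDerivAt (laplace μ) (-∫ y : ℝ, (y : ℂ) * Complex.exp (-s * y) ∂μ) s := by
  have h1 := ProbabilityTheory.hasDerivAt_complexMGF (z := -s)
    (h.mem_interior_integrableExpSet hμ (t := (-s).re) (by simpa using hs))
  have h2 : HasDerivAt (laplace μ) _ s := h1.comp s (hasDerivAt_neg s)
  simpa using h2

lemma differentiableAt_laplace (h : IsSmoothSplitting b p ν f) {μ : Measure ℝ} (hμ : μ ≤ p) {s : ℂ}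
    (hs : |s.re| < b.τ) : DifferentiableAt ℂ (laplace μ) s :=
  (h.hasDerivAt_laplace hμ hs).differentiableAt

lemma norm_laplace_right_le (h : IsSmoothSplitting b p ν f) {σ : ℝ}
    (hσ : σ ≤ b.τ / 2) (hσ' : σ * (2 / b.τ * b.M) ≤ b.δ / 2) {s : ℂ} (hs : |s.re| ≤ σ) :
    ‖laplace ν s‖ ≤ 1 - b.δ / 2 := by
  refine norm_laplace_le.trans (ENNReal.toReal_le_of_le_ofReal ?_ ?_)
  · linarith [b.δ_le]
  · exact (lintegral_mono fun y => tilt_le_absTilt hs y).trans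
      (h.lintegral_absTilt_right_le ((abs_nonneg _).trans hs) hσ hσ')

end IsSmoothSplitting

/-- The quotient `(1 - p̂(s)) / s`, continued analytically to the origin. -/
noncomputable def quot (p : Measure ℝ) : ℂ → ℂ := dslope (fun s => 1 - laplace p s) 0

/-- The function `f̂(s) s / ((1 - ν̂(s)) (1 - p̂(s))) - 1 / (μ_p (s + 1))`, continued analytically
to the origin, where it vanishes. -/
noncomputable def numer (p ν : Measure ℝ) (f : ℝ → ℝ) (s : ℂ) : ℂ :=
  laplace (volume.withDensity fun x => ENNReal.ofReal (f x)) s / ((1 - laplace ν s) * quot p s)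
    - 1 / (mean p * (s + 1))

/-- The analytic continuation of the Laplace transform of `q_p(x) - (1 - exp (-x))₊ / μ_p` to a
strip around the imaginary axis. -/
noncomputable def transform (p ν : Measure ℝ) (f : ℝ → ℝ) : ℂ → ℂ := dslope (numer p ν f) 0

/-- `r` is so small that the estimates for transforms hold in the strip `|Re s| ≤ r`, and `1 - p̂`
is bounded below there with constant `c`. -/
structure IsAdmissible (b : Bounds) (r c : ℝ) : Prop where
  r_pos : 0 < r
  c_pos : 0 < c
  le_ρ : r ≤ b.ρ
  le_half : r ≤ 1 / 2
  mul_le : r * (2 / b.τ * b.M) ≤ b.δ / 2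
  gap : ∀ (p ν : Measure ℝ) (f : ℝ → ℝ), IsSmoothSplitting b p ν f →
    ∀ s : ℂ, |s.re| ≤ r → c * min ‖s‖ 1 ≤ ‖1 - laplace p s‖

lemma exists_isAdmissible (b : Bounds) : ∃ r c, IsAdmissible b r c := by
  obtain ⟨r, hr, c, hc, hρ, h⟩ := exists_spectral_gap b
  have hδ := b.δ_pos
  have hM := b.M_pos
  have hτ := b.τ_pos
  refine ⟨min r (min (1 / 2) (b.δ / 2 / (2 / b.τ * b.M))), c, by positivity, hc,
    (min_le_left _ _).trans hρ, (min_le_right _ _).trans (min_le_left _ _), ?_,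
    fun p ν f hf s hs => h p ν f hf s (hs.trans (min_le_left _ _))⟩
  rw [← le_div_iff₀ (by positivity)]
  exact (min_le_right _ _).trans (min_le_right _ _)

lemma IsAdmissible.le_τ {b : Bounds} {r c : ℝ} (ha : IsAdmissible b r c) : r ≤ b.τ / 2 :=
  ha.le_ρ.trans b.ρ_le

/-- The constant in the bound for the transform at points of modulus at least `κ`. -/
noncomputable def Bounds.C (b : Bounds) (c κ : ℝ) : ℝ :=
  (b.M + Real.exp (b.τ * b.T) * b.B) / (b.δ / 2 * (c * κ)) * (2 / κ ^ 2) + 4 / (b.m * κ)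

namespace IsSmoothSplitting

variable {b : Bounds} {p ν : Measure ℝ} {f : ℝ → ℝ} {r c : ℝ}

lemma mean_pos (h : IsSmoothSplitting b p ν f) : 0 < mean p := b.m_pos.trans_le h.mean_ge

lemma laplace_zero (h : IsSmoothSplitting b p ν f) : laplace p 0 = 1 := by
  have := h.prob
  simp [laplace]

lemma quot_zero (h : IsSmoothSplitting b p ν f) : quot p 0 = mean p := by
  have h1 := h.hasDerivAt_laplace le_rfl (s := 0) (by simpa using b.τ_pos)
  have h2 := (h1.const_sub 1).deriv
  rw [quot, dslope_same, h2, neg_neg]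
  simpa [mean] using integral_complex_ofReal

lemma quot_of_ne (h : IsSmoothSplitting b p ν f) {s : ℂ} (hs : s ≠ 0) :
    quot p s = (1 - laplace p s) / s := by
  rw [quot, dslope_of_ne _ hs, slope_def_field, h.laplace_zero]
  simp

lemma one_sub_laplace_ne (h : IsSmoothSplitting b p ν f) (ha : IsAdmissible b r c) {s : ℂ}
    (hs : |s.re| ≤ r) (h0 : s ≠ 0) : 1 - laplace p s ≠ 0 := by
  have h1 := ha.gap p ν f h s hs
  have h2 : 0 < c * min ‖s‖ 1 := mul_pos ha.c_pos (lt_min (norm_pos_iff.2 h0) one_pos)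
  exact norm_pos_iff.1 (h2.trans_le h1)

lemma quot_ne_zero (h : IsSmoothSplitting b p ν f) (ha : IsAdmissible b r c) {s : ℂ}
    (hs : |s.re| ≤ r) : quot p s ≠ 0 := by
  by_cases h0 : s = 0
  · rw [h0, h.quot_zero]; exact_mod_cast h.mean_pos.ne'
  · rw [h.quot_of_ne h0]
    exact div_ne_zero (h.one_sub_laplace_ne ha hs h0) h0

lemma norm_one_sub_right_ge (h : IsSmoothSplitting b p ν f) (ha : IsAdmissible b r c) {s : ℂ}
    (hs : |s.re| ≤ r) : b.δ / 2 ≤ ‖1 - laplace ν s‖ := by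
  have h1 := h.norm_laplace_right_le ha.le_τ ha.mul_le hs
  have h2 := norm_sub_norm_le (1 : ℂ) (laplace ν s)
  rw [norm_one] at h2
  linarith

lemma one_sub_right_ne (h : IsSmoothSplitting b p ν f) (ha : IsAdmissible b r c) {s : ℂ}
    (hs : |s.re| ≤ r) : 1 - laplace ν s ≠ 0 :=
  norm_pos_iff.1 ((half_pos b.δ_pos).trans_le (h.norm_one_sub_right_ge ha hs))

lemma numer_zero (h : IsSmoothSplitting b p ν f) (ha : IsAdmissible b r c) :
    numer p ν f 0 = 0 := by
  have h1 := h.lintegral_tilt_lt_top_of_le h.left_le (ε := (0 : ℂ).re) (by simpa using b.τ_pos.le)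
  have h2 := h.lintegral_tilt_lt_top_of_le h.right_le (ε := (0 : ℂ).re) (by simpa using b.τ_pos.le)
  have h3 := laplace_add h1 h2
  rw [← h.split, h.laplace_zero] at h3
  have h4 : laplace (volume.withDensity fun x => ENNReal.ofReal (f x)) 0 = 1 - laplace ν 0 := by
    linear_combination -h3
  have h5 := h.one_sub_right_ne ha (s := 0) (by simpa using ha.r_pos.le)
  have h6 : (mean p : ℂ) ≠ 0 := by exact_mod_cast h.mean_pos.ne'
  rw [numer, h4, h.quot_zero]
  field_simp
  simp

lemma strip_mem_nhds (ha : IsAdmissible b r c) : {s : ℂ | |s.re| < r} ∈ 𝓝 (0 : ℂ) :=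
  (isOpen_lt (by fun_prop) continuous_const).mem_nhds (by simpa using ha.r_pos)

lemma differentiableOn_transform (h : IsSmoothSplitting b p ν f) (ha : IsAdmissible b r c) :
    DifferentiableOn ℂ (transform p ν f) {s : ℂ | |s.re| < r} := by
  have hτ : ∀ s ∈ {s : ℂ | |s.re| < r}, |s.re| < b.τ := fun s hs =>
    lt_of_lt_of_le hs (ha.le_τ.trans (by linarith [b.τ_pos]))
  have h1 : ∀ μ ≤ p, DifferentiableOn ℂ (laplace μ) {s : ℂ | |s.re| < r} := fun μ hμ s hs =>
    (h.differentiableAt_laplace hμ (hτ s hs)).differentiableWithinAt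
  have h2 : DifferentiableOn ℂ (quot p) {s : ℂ | |s.re| < r} :=
    (Complex.differentiableOn_dslope (strip_mem_nhds ha)).2 ((h1 p le_rfl).const_sub 1)
  refine (Complex.differentiableOn_dslope (strip_mem_nhds ha)).2 (DifferentiableOn.sub ?_ ?_)
  · refine (h1 _ h.left_le).div (((h1 _ h.right_le).const_sub 1).mul h2) fun s hs => ?_
    have hs' : |s.re| ≤ r := le_of_lt hs
    exact mul_ne_zero (h.one_sub_right_ne ha hs') (h.quot_ne_zero ha hs')
  · refine DifferentiableOn.div (by fun_prop) (by fun_prop) fun s hs => ?_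
    refine mul_ne_zero (by exact_mod_cast h.mean_pos.ne') fun h0 => ?_
    have h3 := congrArg Complex.re h0
    simp only [Complex.add_re, Complex.one_re, Complex.zero_re] at h3
    have h4 : |s.re| < r := hs
    have := (abs_lt.1 h4).1
    linarith [ha.le_half]

lemma transform_of_ne (h : IsSmoothSplitting b p ν f) (ha : IsAdmissible b r c) {s : ℂ}
    (hs : |s.re| ≤ r) (h0 : s ≠ 0) :
    transform p ν f s = laplace (volume.withDensity fun x => ENNReal.ofReal (f x)) s /
      ((1 - laplace ν s) * (1 - laplace p s)) - 1 / (mean p * (s * (s + 1))) := by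
  rw [transform, dslope_of_ne _ h0, slope_def_field, h.numer_zero ha, numer, h.quot_of_ne h0]
  have h1 := h.one_sub_laplace_ne ha hs h0
  have h2 := h.one_sub_right_ne ha hs
  have h3 : (mean p : ℂ) ≠ 0 := by exact_mod_cast h.mean_pos.ne'
  have h4 : s + 1 ≠ 0 := fun h0 => by
    have h3 := congrArg Complex.re h0
    simp only [Complex.add_re, Complex.one_re, Complex.zero_re] at h3
    have := (abs_le.1 hs).1
    linarith [ha.le_half]
  rw [sub_zero, sub_zero]
  field_simp

/-- Quadratic decay of the transform on vertical lines. -/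
lemma norm_transform_le (h : IsSmoothSplitting b p ν f) (ha : IsAdmissible b r c) {s : ℂ}
    (hs : |s.re| ≤ r) {κ : ℝ} (h0 : 0 < κ) (h1 : κ ≤ 1) (hκ : κ ≤ ‖s‖) :
    ‖transform p ν f s‖ ≤ b.C c κ / (1 + s.im ^ 2) := by
  have hδ := b.δ_pos
  have hm := b.m_pos
  have hM := b.M_pos
  have hB := b.B_pos
  have hT := b.T_pos
  have hτ := b.τ_pos
  have hc := ha.c_pos
  have hsp : 0 < ‖s‖ := h0.trans_le hκ
  have hs0 : s ≠ 0 := norm_pos_iff.1 hsp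
  have hsτ : |s.re| ≤ b.τ := hs.trans (ha.le_τ.trans (by linarith))
  have hsq : κ ^ 2 / 2 * (1 + s.im ^ 2) ≤ ‖s‖ ^ 2 := by
    have e1 : κ ^ 2 ≤ ‖s‖ ^ 2 := by gcongr
    have e2 : s.im ^ 2 ≤ ‖s‖ ^ 2 := by
      rw [← sq_abs s.im]; gcongr; exact Complex.abs_im_le_norm s
    have e3 : κ ^ 2 * s.im ^ 2 ≤ 1 * s.im ^ 2 := by gcongr; exact pow_le_one₀ h0.le h1
    linarith
  have hsq1 : 1 / 4 * (1 + s.im ^ 2) ≤ ‖s + 1‖ ^ 2 := by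
    rw [Complex.sq_norm, Complex.normSq_apply]
    simp only [Complex.add_re, Complex.one_re, Complex.add_im, Complex.one_im, add_zero]
    have := (abs_le.1 hs).1
    nlinarith [ha.le_half]
  have hprod : κ / 4 * (1 + s.im ^ 2) ≤ ‖s * (s + 1)‖ := by
    refine le_of_sq_le_sq ?_ (norm_nonneg _)
    rw [norm_mul, mul_pow ‖s‖]
    calc (κ / 4 * (1 + s.im ^ 2)) ^ 2
        ≤ (κ ^ 2 / 2 * (1 + s.im ^ 2)) * (1 / 4 * (1 + s.im ^ 2)) := by
          have : 0 ≤ κ ^ 2 * (1 + s.im ^ 2) ^ 2 := by positivity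
          linarith
      _ ≤ _ := by gcongr
  have hβ : ‖laplace (volume.withDensity fun x => ENNReal.ofReal (f x)) s‖ ≤
      (b.M + Real.exp (b.τ * b.T) * b.B) * (2 / κ ^ 2) / (1 + s.im ^ 2) := by
    have e1 := h.norm_laplace_left_le hsτ
    have e2 := h.sq_mul_norm_laplace_left_le s
    have e3 : Real.exp (|s.re| * b.T) * b.B ≤ Real.exp (b.τ * b.T) * b.B := by gcongr
    have e4 : 0 ≤ b.M := hM.le
    rw [le_div_iff₀ (by positivity)]
    set X := ‖laplace (volume.withDensity fun x => ENNReal.ofReal (f x)) s‖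
    have e5 : X * (1 + s.im ^ 2) = (κ ^ 2 / 2 * (1 + s.im ^ 2)) * X * (2 / κ ^ 2) := by
      field_simp
    rw [e5]
    gcongr
    calc _ ≤ ‖s‖ ^ 2 * X := by gcongr
      _ ≤ _ := by linarith
  have hgap : c * κ ≤ ‖1 - laplace p s‖ := by
    refine le_trans ?_ (ha.gap p ν f h s hs)
    gcongr
    exact le_min hκ h1
  rw [h.transform_of_ne ha hs hs0]
  refine (norm_sub_le _ _).trans ?_
  rw [Bounds.C, add_div]
  refine add_le_add ?_ ?_
  · rw [norm_div, norm_mul]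
    calc _ ≤ (b.M + Real.exp (b.τ * b.T) * b.B) * (2 / κ ^ 2) / (1 + s.im ^ 2) /
          (b.δ / 2 * (c * κ)) := by
          gcongr
          exact h.norm_one_sub_right_ge ha hs
      _ = _ := by field_simp
  · rw [norm_div, norm_one, norm_mul, Complex.norm_real, Real.norm_eq_abs,
      abs_of_pos h.mean_pos]
    have := h.mean_pos
    calc _ ≤ 1 / (b.m * (κ / 4 * (1 + s.im ^ 2))) := by
          gcongr
          exact h.mean_ge
      _ = _ := by field_simp

lemma integral_cexp_mul_density_sub (h : IsSmoothSplitting b p ν f) (ha : IsAdmissible b r c)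
    {s : ℂ} (h0 : 0 < s.re) (hs : s.re ≤ r) :
    ∫ x : ℝ, Complex.exp (-s * x) * (density p ν f x - (mean p)⁻¹ * oneSubExp x : ℝ) =
      transform p ν f s := by
  have hs' : |s.re| ≤ r := by rwa [abs_of_pos h0]
  have hs0 : s ≠ 0 := by rintro rfl; simp at h0
  have e : ∀ x : ℝ,
      Complex.exp (-s * x) * (density p ν f x - (mean p)⁻¹ * oneSubExp x : ℝ) =
      Complex.exp (-s * x) * density p ν f x -
        (mean p : ℂ)⁻¹ * (Complex.exp (-s * x) * oneSubExp x) := by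
    intro x; push_cast; ring
  simp only [e]
  rw [integral_sub (h.integrable_cexp_mul_density h0 (hs.trans ha.le_ρ))
    ((integrable_cexp_mul_oneSubExp h0).const_mul _), integral_const_mul,
    integral_cexp_mul_oneSubExp h0, ← h.laplace_density, h.transform_of_ne ha hs' hs0]
  have h1 := h.laplace_density_mul h0 (hs.trans ha.le_ρ)
  rw [← eq_div_iff (mul_ne_zero (h.one_sub_right_ne ha hs')
    (h.one_sub_laplace_ne ha hs' hs0))] at h1
  rw [h1]
  congr 1
  simp only [one_div, mul_inv]

lemma integrable_cexp_mul_density_sub (h : IsSmoothSplitting b p ν f) (ha : IsAdmissible b r c)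
    {s : ℂ} (h0 : 0 < s.re) (hs : s.re ≤ r) :
    Integrable fun x : ℝ =>
      Complex.exp (-s * x) * (density p ν f x - (mean p)⁻¹ * oneSubExp x : ℝ) := by
  refine ((h.integrable_cexp_mul_density h0 (hs.trans ha.le_ρ)).sub
    ((integrable_cexp_mul_oneSubExp h0).const_mul ((mean p : ℂ)⁻¹))).congr (.of_forall fun x => ?_)
  simp only [Pi.sub_apply]
  push_cast; ring

lemma norm_transform_line_le (h : IsSmoothSplitting b p ν f) (ha : IsAdmissible b r c) {t : ℝ}
    (ht0 : t ≠ 0) (ht : |t| ≤ r) (θ : ℝ) :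
    ‖transform p ν f (t + θ * Complex.I)‖ ≤ b.C c |t| / (1 + θ ^ 2) := by
  have := h.norm_transform_le ha (s := t + θ * Complex.I) (by simpa using ht) (κ := |t|)
    (abs_pos.2 ht0) (ht.trans (ha.le_half.trans (by norm_num)))
    (by simpa using Complex.abs_re_le_norm (t + θ * Complex.I))
  simpa using this

lemma continuous_transform_line (h : IsSmoothSplitting b p ν f) (ha : IsAdmissible b r c) {t : ℝ}
    (ht : |t| < r) : Continuous fun θ : ℝ => transform p ν f (t + θ * Complex.I) :=
  (h.differentiableOn_transform ha).continuousOn.comp_continuous (by fun_prop)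
    fun θ => by simpa using ht

lemma integrable_transform_line (h : IsSmoothSplitting b p ν f) (ha : IsAdmissible b r c) {t : ℝ}
    (ht0 : t ≠ 0) (ht : |t| < r) :
    Integrable fun θ : ℝ => transform p ν f (t + θ * Complex.I) := by
  refine (integrable_inv_one_add_sq.const_mul (b.C c |t|)).mono'
    (h.continuous_transform_line ha ht).aestronglyMeasurable (.of_forall fun θ => ?_)
  rw [← div_eq_mul_inv]
  exact h.norm_transform_line_le ha ht0 ht.le θ

/-- Fourier inversion on the line `Re s = t`. -/
lemma density_sub_eq (h : IsSmoothSplitting b p ν f) (ha : IsAdmissible b r c) {t : ℝ}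
    (ht0 : 0 < t) (ht : t < r) {x : ℝ} (hx : 0 < x) :
    ((density p ν f x - (mean p)⁻¹ * oneSubExp x : ℝ) : ℂ) =
      (2 * Real.pi : ℝ)⁻¹ • ∫ θ : ℝ, Complex.exp ((t + θ * Complex.I) * x) *
        transform p ν f (t + θ * Complex.I) := by
  set g : ℝ → ℝ := fun x => density p ν f x - (mean p)⁻¹ * oneSubExp x with hg
  set F : ℝ → ℂ := fun x => Complex.exp (-(t : ℂ) * x) * g x with hF
  have hFi : Integrable F :=
    h.integrable_cexp_mul_density_sub ha (s := t) (by simpa) (by simpa using ht.le)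
  have hFF : FourierTransform.fourier F =
      fun w => transform p ν f (t + (2 * Real.pi * w : ℝ) * Complex.I) := by
    ext w
    rw [← h.integral_cexp_mul_density_sub ha (s := t + (2 * Real.pi * w : ℝ) * Complex.I)
      (by simpa using ht0) (by simpa using ht.le), Real.fourier_real_eq_integral_exp_smul]
    congr 1 with v
    rw [smul_eq_mul, hF]
    simp only
    rw [← mul_assoc, ← Complex.exp_add]
    congr 2
    push_cast; ring
  have hpi : (2 * Real.pi : ℝ) ≠ 0 := by positivity
  have hFFi : Integrable (FourierTransform.fourier F) := by
    rw [hFF]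
    exact (h.integrable_transform_line ha ht0.ne' (by rwa [abs_of_pos ht0])).comp_mul_left' hpi
  have hcont : ContinuousAt F x := by
    have h1 : ContinuousAt oneSubExp x := by
      have : ContinuousAt (fun x => 1 - Real.exp (-x)) x := by fun_prop
      refine this.congr ?_
      filter_upwards [Ioi_mem_nhds hx] with y hy
      rw [oneSubExp, indicator_of_mem hy]
    have h2 : ContinuousAt g x := h.continuous_density.continuousAt.sub (continuousAt_const.mul h1)
    exact ContinuousAt.mul (by fun_prop) (Complex.continuous_ofReal.continuousAt.comp h2)
  have hinv := hFi.fourierInv_fourier_eq hFFi hcont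
  rw [Real.fourierInv_eq', hFF] at hinv
  have e1 : (g x : ℂ) = Complex.exp (t * x) * F x := by
    rw [hF]
    simp only
    rw [← mul_assoc, ← Complex.exp_add]
    simp
  rw [e1, ← hinv, ← integral_const_mul]
  have e2 := Measure.integral_comp_mul_left (fun θ : ℝ =>
    Complex.exp ((t + θ * Complex.I) * x) * transform p ν f (t + θ * Complex.I)) (2 * Real.pi)
  rw [abs_of_pos (by positivity)] at e2
  rw [← e2]
  congr 1 with w
  rw [smul_eq_mul, ← mul_assoc, ← Complex.exp_add]
  congr 2
  simp
  ring

/-- The density of the renewal measure converges exponentially fast, with constants that depend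
only on the bounds. -/
lemma abs_density_sub_le (h : IsSmoothSplitting b p ν f) (ha : IsAdmissible b r c) {t : ℝ}
    (ht0 : 0 < t) (ht : t < r) {x : ℝ} (hx : 0 < x) :
    Real.exp (t * x) * |density p ν f x - (mean p)⁻¹| ≤ b.C c t + 1 / b.m := by
  set G : ℂ → ℂ := fun s => Complex.exp (s * x) * transform p ν f s with hG
  have hta : |t| < r := by rwa [abs_of_pos ht0]
  have hta' : |-t| < r := by rwa [abs_neg]
  have hGi : ∀ u : ℝ, u ≠ 0 → |u| < r → Integrable fun θ : ℝ => G (u + θ * Complex.I) := by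
    intro u hu0 hu
    refine (h.integrable_transform_line ha hu0 hu).bdd_mul (c := Real.exp (u * x))
      (by fun_prop) (.of_forall fun θ => ?_)
    rw [Complex.norm_exp]; simp
  -- Shift the contour from `Re s = t` to `Re s = -t`.
  have hshift : ∫ θ : ℝ, G ((-t : ℝ) + θ * Complex.I) = ∫ θ : ℝ, G (t + θ * Complex.I) := by
    have hstrip : ∀ s : ℂ, -t ≤ s.re → s.re ≤ t → |s.re| < r := fun s h1 h2 =>
      (abs_le.2 ⟨h1, h2⟩).trans_lt ht
    refine integral_vertical_eq (C := Real.exp (t * x) * b.C c 1) (by linarith)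
      (fun s h1 h2 => ?_) (fun s h1 h2 h3 => ?_) (hGi _ (by linarith) hta') (hGi _ ht0.ne' hta)
    · refine DifferentiableAt.mul (by fun_prop) ?_
      exact (h.differentiableOn_transform ha).differentiableAt
        ((isOpen_lt (by fun_prop) continuous_const).mem_nhds (hstrip s h1 h2))
    · have h4 := h.norm_transform_le ha (hstrip s h1 h2).le one_pos le_rfl
        (h3.trans (Complex.abs_im_le_norm s))
      rw [hG]
      simp only
      rw [norm_mul, Complex.norm_exp, mul_div_assoc]
      gcongr
      simp only [Complex.mul_re, Complex.ofReal_re, Complex.ofReal_im, mul_zero, sub_zero]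
      gcongr
  have h1 := h.density_sub_eq ha ht0 ht hx
  rw [show (∫ θ : ℝ, Complex.exp ((t + θ * Complex.I) * x) * transform p ν f (t + θ * Complex.I))
    = ∫ θ : ℝ, G (t + θ * Complex.I) from rfl, ← hshift] at h1
  have h2 : ‖∫ θ : ℝ, G ((-t : ℝ) + θ * Complex.I)‖ ≤
      Real.exp (-(t * x)) * (b.C c t * Real.pi) := by
    rw [← integral_univ_inv_one_add_sq, ← integral_const_mul, ← integral_const_mul]
    refine norm_integral_le_of_norm_le
      ((integrable_inv_one_add_sq.const_mul _).const_mul _) (.of_forall fun θ => ?_)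
    have h4 := h.norm_transform_line_le ha (t := -t) (by linarith) hta'.le θ
    rw [abs_neg, abs_of_pos ht0] at h4
    rw [hG]
    simp only
    rw [norm_mul, Complex.norm_exp, ← div_eq_mul_inv]
    gcongr
    simp
  have h3 : |density p ν f x - (mean p)⁻¹ * oneSubExp x| ≤ Real.exp (-(t * x)) * b.C c t := by
    rw [← Real.norm_eq_abs, ← Complex.norm_real, h1, norm_smul, Real.norm_eq_abs,
      abs_of_pos (by positivity : 0 < (2 * Real.pi)⁻¹)]
    have hp := Real.pi_pos
    calc _ ≤ (2 * Real.pi)⁻¹ * (Real.exp (-(t * x)) * (b.C c t * Real.pi)) := by gcongr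
      _ = Real.exp (-(t * x)) * b.C c t / 2 := by field_simp
      _ ≤ _ := by
        have := (norm_nonneg _).trans h2
        have h5 : 0 ≤ Real.exp (-(t * x)) * b.C c t := by
          rw [← mul_assoc] at this
          exact nonneg_of_mul_nonneg_left this hp
        linarith
  have h4 : |(mean p)⁻¹ * oneSubExp x - (mean p)⁻¹| ≤ Real.exp (-(t * x)) * (1 / b.m) := by
    rw [oneSubExp, indicator_of_mem (mem_Ioi.2 hx)]
    have hm := b.m_pos
    have hmp := h.mean_pos
    rw [show (mean p)⁻¹ * (1 - Real.exp (-x)) - (mean p)⁻¹ =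
        -(Real.exp (-x) * (1 / mean p)) by ring,
      abs_neg, abs_of_nonneg (by positivity)]
    gcongr
    · have : t ≤ 1 := ht.le.trans (ha.le_half.trans (by norm_num))
      nlinarith
    · exact h.mean_ge
  have h5 : |density p ν f x - (mean p)⁻¹| ≤ Real.exp (-(t * x)) * (b.C c t + 1 / b.m) := by
    have := abs_add_le (density p ν f x - (mean p)⁻¹ * oneSubExp x)
      ((mean p)⁻¹ * oneSubExp x - (mean p)⁻¹)
    rw [sub_add_sub_cancel] at this
    linarith
  calc _ ≤ Real.exp (t * x) * (Real.exp (-(t * x)) * (b.C c t + 1 / b.m)) := by gcongr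
    _ = _ := by rw [← mul_assoc, ← Real.exp_add]; simp

end IsSmoothSplitting

/-! ### The renewal equation on the whole line -/

lemma measurable_integral_sub {g : ℝ → ℝ} (hg : Measurable g) (κ : Measure ℝ) [SFinite κ] :
    Measurable fun x => ∫ y, g (x - y) ∂κ := by
  have : StronglyMeasurable fun z : ℝ × ℝ => g (z.1 - z.2) :=
    (hg.comp (measurable_fst.sub measurable_snd)).stronglyMeasurable
  exact this.integral_prod_right'.measurable

/-- The values on `[0, ∞)` of a function, extended by zero to the whole line. -/
noncomputable def extend (Z : ℝ → ℝ) : ℝ → ℝ := (Ici (0 : ℝ)).indicator Z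

/-- The function `Z - p * Z` on the whole line, where `Z` is extended by zero from `[0, ∞)`. If `Z`
solves the renewal equation, it is the inhomogeneous term on `[0, ∞)`. -/
noncomputable def defect (p : Measure ℝ) (Z : ℝ → ℝ) (x : ℝ) : ℝ :=
  extend Z x - ∫ y, extend Z (x - y) ∂p

lemma extend_of_nonneg {Z : ℝ → ℝ} {x : ℝ} (hx : 0 ≤ x) : extend Z x = Z x :=
  indicator_of_mem (mem_Ici.2 hx) Z

lemma extend_of_neg {Z : ℝ → ℝ} {x : ℝ} (hx : x < 0) : extend Z x = 0 :=
  indicator_of_notMem (by simpa using hx) Z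

lemma setIntegral_Iic_eq (p : Measure ℝ) (Z : ℝ → ℝ) (x : ℝ) :
    ∫ y in Iic x, Z (x - y) ∂p = ∫ y, extend Z (x - y) ∂p := by
  rw [← integral_indicator measurableSet_Iic]
  congr 1 with y
  by_cases hy : y ≤ x
  · rw [indicator_of_mem (mem_Iic.2 hy), extend_of_nonneg (by linarith)]
  · rw [indicator_of_notMem (by simpa using hy), extend_of_neg (by linarith)]

lemma abs_extend_le {Z : ℝ → ℝ} {ε K : ℝ} (hZ : ∀ x, 0 ≤ x → |Z x| ≤ K * Real.exp (ε * x))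
    (x : ℝ) : |extend Z x| ≤ K * Real.exp (ε * x) := by
  have hK : 0 ≤ K := by simpa using (abs_nonneg _).trans (hZ 0 le_rfl)
  rcases le_or_gt 0 x with hx | hx
  · rw [extend_of_nonneg hx]; exact hZ x hx
  · rw [extend_of_neg hx, abs_zero]; positivity

lemma IsRenewalSolution.measurable_extend {p : Measure ℝ} {z Z : ℝ → ℝ}
    (h : IsRenewalSolution p z Z) : Measurable (extend Z) := by
  refine measurable_of_restrict_of_restrict_compl (s := Ici 0) measurableSet_Ici ?_ ?_
  · refine (congrArg Measurable ?_).mpr h.measurable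
    ext x; exact extend_of_nonneg x.2
  · refine (congrArg Measurable ?_).mpr (measurable_const (a := (0 : ℝ)))
    ext x; exact extend_of_neg (by simpa using x.2)

lemma IsRenewalSolution.defect_eq {p : Measure ℝ} {z Z : ℝ → ℝ}
    (h : IsRenewalSolution p z Z) {x : ℝ} (hx : 0 ≤ x) : defect p Z x = z x := by
  rw [defect, extend_of_nonneg hx, ← setIntegral_Iic_eq, h.eq x hx]; ring

lemma IsRenewalSolution.measurable_defect {p : Measure ℝ} [SFinite p] {z Z : ℝ → ℝ}
    (h : IsRenewalSolution p z Z) : Measurable (defect p Z) :=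
  h.measurable_extend.sub (measurable_integral_sub h.measurable_extend p)

lemma integrable_comp_sub {κ : Measure ℝ} {ε K : ℝ} (hκ : ∫⁻ y, tilt ε y ∂κ < ∞) {g : ℝ → ℝ}
    (hg : Measurable g) (hb : ∀ x, |g x| ≤ K * Real.exp (ε * x)) (x : ℝ) :
    Integrable (fun y => g (x - y)) κ := by
  refine ((integrable_tilt hκ).const_mul (K * Real.exp (ε * x))).mono'
    (hg.comp (by fun_prop)).aestronglyMeasurable (.of_forall fun y => ?_)
  rw [mul_assoc, ← Real.exp_add]
  refine (hb (x - y)).trans (le_of_eq ?_)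
  ring_nf

lemma abs_integral_sub_le {κ : Measure ℝ} {ε K : ℝ} (hκ : ∫⁻ y, tilt ε y ∂κ < ∞) {g : ℝ → ℝ}
    (hb : ∀ x, |g x| ≤ K * Real.exp (ε * x)) (x : ℝ) :
    |∫ y, g (x - y) ∂κ| ≤ K * (∫⁻ y, tilt ε y ∂κ).toReal * Real.exp (ε * x) := by
  calc |∫ y, g (x - y) ∂κ| ≤ ∫ y, K * Real.exp (ε * x) * Real.exp (-(ε * y)) ∂κ := by
        rw [← Real.norm_eq_abs]
        refine norm_integral_le_of_norm_le ((integrable_tilt hκ).const_mul _)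
          (.of_forall fun y => ?_)
        rw [mul_assoc, ← Real.exp_add]
        refine (hb (x - y)).trans (le_of_eq ?_)
        ring_nf
    _ = _ := by rw [integral_const_mul, integral_tilt]; ring

/-- A function dominated by its own convolution with `p` vanishes if its growth is so slow that
`p` is contracting in the corresponding weighted norm. -/
lemma eq_zero_of_abs_le_integral {p : Measure ℝ} {ε : ℝ} (hp : ∫⁻ y, tilt ε y ∂p < 1) {W : ℝ → ℝ}
    {K : ℝ} (hb : ∀ x, |W x| ≤ K * Real.exp (ε * x))
    (hW : ∀ x, |W x| ≤ |∫ y, W (x - y) ∂p|) (x : ℝ) : W x = 0 := by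
  set q := (∫⁻ y, tilt ε y ∂p).toReal with hq
  have hq1 : q < 1 := by
    rw [hq, ← ENNReal.toReal_one]
    exact (ENNReal.toReal_lt_toReal hp.ne_top ENNReal.one_ne_top).2 hp
  have hn : ∀ n : ℕ, ∀ x, |W x| ≤ K * q ^ n * Real.exp (ε * x) := by
    intro n
    induction n with
    | zero => simpa using hb
    | succ n ih =>
      intro x
      refine (hW x).trans ((abs_integral_sub_le (hp.trans ENNReal.one_lt_top) ih x).trans ?_)
      rw [pow_succ, mul_assoc K]
  have hl : Tendsto (fun n : ℕ => K * q ^ n * Real.exp (ε * x)) atTop (𝓝 0) := by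
    simpa using ((tendsto_pow_atTop_nhds_zero_of_lt_one ENNReal.toReal_nonneg hq1).const_mul
      K).mul_const (Real.exp (ε * x))
  exact abs_nonpos_iff.1 (ge_of_tendsto' hl fun n => hn n x)

/-- `Z` grows more slowly than every exponential function. -/
def IsSubexp (Z : ℝ → ℝ) : Prop :=
  ∀ ε > 0, ∃ K : ℝ, ∀ x, 0 ≤ x → |Z x| ≤ K * Real.exp (ε * x)

lemma neg_mul_abs_le {ε η : ℝ} (h0 : 0 ≤ ε) (h : ε ≤ η) (x : ℝ) : -(η * |x|) ≤ ε * x := by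
  have h1 : ε * -|x| ≤ ε * x := mul_le_mul_of_nonneg_left (neg_abs_le x) h0
  have h2 : ε * |x| ≤ η * |x| := by gcongr
  linarith

lemma integral_exp_neg_abs {η : ℝ} (hη : 0 < η) :
    ∫ x : ℝ, Real.exp (-(η * |x|)) = 2 / η := by
  rw [integral_comp_abs (f := fun x => Real.exp (-(η * x)))]
  have := integral_exp_mul_Ioi (neg_lt_zero.2 hη) 0
  simp only [neg_mul] at this
  rw [this]
  simp [div_eq_mul_inv]

lemma integrable_exp_neg_abs {η : ℝ} (hη : 0 < η) :
    Integrable fun x : ℝ => Real.exp (-(η * |x|)) := by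
  refine .of_integral_ne_zero ?_
  rw [integral_exp_neg_abs hη]
  positivity

namespace IsSmoothSplitting

variable {b : Bounds} {p ν : Measure ℝ} {f : ℝ → ℝ} {z Z : ℝ → ℝ}

lemma renewalSolution_unique (h : IsSmoothSplitting b p ν f) {Z' : ℝ → ℝ}
    (hZ : IsRenewalSolution p z Z) (hZ' : IsRenewalSolution p z Z') (hg : IsSubexp Z)
    (hg' : IsSubexp Z') : EqOn Z Z' (Ici 0) := by
  obtain ⟨K, hK⟩ := hg b.ρ b.ρ_pos
  obtain ⟨K', hK'⟩ := hg' b.ρ b.ρ_pos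
  have hp1 := h.lintegral_tilt_lt_one b.ρ_pos le_rfl
  have hp := hp1.trans ENNReal.one_lt_top
  have key := eq_zero_of_abs_le_integral hp1 (W := fun x => extend Z x - extend Z' x)
    (K := K + K') (fun x => ?_) (fun x => ?_)
  · intro x hx
    have := key x
    simp only [extend_of_nonneg (mem_Ici.1 hx)] at this
    linarith
  · have h1 := abs_extend_le hK x
    have h2 := abs_extend_le hK' x
    have h3 := abs_sub (extend Z x) (extend Z' x)
    rw [add_mul]
    exact h3.trans (add_le_add h1 h2)
  · rcases le_or_gt 0 x with hx | hx
    · rw [integral_sub (integrable_comp_sub hp hZ.measurable_extend (abs_extend_le hK) x)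
        (integrable_comp_sub hp hZ'.measurable_extend (abs_extend_le hK') x),
        ← setIntegral_Iic_eq, ← setIntegral_Iic_eq, extend_of_nonneg hx, extend_of_nonneg hx,
        hZ.eq x hx, hZ'.eq x hx]
      refine le_of_eq ?_
      ring_nf
    · rw [extend_of_neg hx, extend_of_neg hx]; simp

/-- The tilted mass of `p` is at most the exponential moment. -/
lemma toReal_lintegral_tilt_le (h : IsSmoothSplitting b p ν f) {η : ℝ} (hη : |η| ≤ b.τ) :
    (∫⁻ y, tilt η y ∂p).toReal ≤ (∫⁻ y, absTilt b.τ y ∂p).toReal :=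
  ENNReal.toReal_mono (h.moment_le.trans_lt ENNReal.ofReal_lt_top).ne
    (lintegral_mono fun y => tilt_le_absTilt hη y)

/-- The defect decays exponentially on both sides: on the right it is `z`, and on the left it is
controlled by the growth of `Z` and the exponential moment of `p`. -/
lemma abs_defect_le (h : IsSmoothSplitting b p ν f) (hZ : IsRenewalSolution p z Z) {η L L₂ : ℝ}
    (hη : 0 < η) (hητ : η ≤ b.τ) (hz : ∀ x, 0 ≤ x → |z x| ≤ L * Real.exp (-(η * x)))
    (hL₂ : ∀ x, 0 ≤ x → |Z x| ≤ L₂ * Real.exp (η * x))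
    (hL : L₂ * (∫⁻ y, absTilt b.τ y ∂p).toReal ≤ L) (x : ℝ) :
    |defect p Z x| ≤ L * Real.exp (-(η * |x|)) := by
  have hη' : |η| ≤ b.τ := by rwa [abs_of_pos hη]
  rcases le_or_gt 0 x with hx | hx
  · rw [hZ.defect_eq hx, abs_of_nonneg hx]; exact hz x hx
  · rw [defect, extend_of_neg hx, zero_sub, abs_neg, abs_of_neg hx]
    have h1 := abs_integral_sub_le (h.lintegral_tilt_lt_top hη') (abs_extend_le hL₂) x
    have hK : 0 ≤ L₂ := by simpa using (abs_nonneg _).trans (hL₂ 0 le_rfl)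
    rw [mul_neg, neg_neg]
    refine h1.trans ?_
    gcongr
    refine le_trans (mul_le_mul_of_nonneg_left ?_ hK) hL
    exact h.toReal_lintegral_tilt_le hη'

/-- The solution of the renewal equation is the convolution of the defect with the renewal
measure. -/
lemma extend_eq_integral (h : IsSmoothSplitting b p ν f) (hZ : IsRenewalSolution p z Z)
    (hg : IsSubexp Z) {η L : ℝ} (hη : 0 < η)
    (hd : ∀ x, |defect p Z x| ≤ L * Real.exp (-(η * |x|))) (x : ℝ) :
    extend Z x = ∫ y, defect p Z (x - y) ∂(renewalMeasure p) := by
  have := h.prob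
  have hL : 0 ≤ L := by simpa using (abs_nonneg _).trans (hd 0)
  set ε := min b.ρ η with hε
  have hε0 : 0 < ε := lt_min b.ρ_pos hη
  obtain ⟨K, hK⟩ := hg ε hε0
  have hp1 := h.lintegral_tilt_lt_one hε0 (min_le_left _ _)
  have hp := hp1.trans ENNReal.one_lt_top
  have hN := lintegral_tilt_renewalMeasure_lt_top hp1
  have hd' : ∀ x, |defect p Z x| ≤ L * Real.exp (ε * x) := by
    intro x
    refine (hd x).trans ?_
    gcongr
    exact neg_mul_abs_le hε0.le (min_le_right _ _) x
  have hm := hZ.measurable_defect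
  have hi := integrable_comp_sub hN hm hd'
  have hV := abs_integral_sub_le hN hd'
  have hVm := measurable_integral_sub hm (renewalMeasure p)
  set V : ℝ → ℝ := fun x => ∫ y, defect p Z (x - y) ∂(renewalMeasure p) with hVdef
  have hVeq : ∀ x, V x = defect p Z x + ∫ y, V (x - y) ∂p := by
    intro x
    have hi' : Integrable (fun y => defect p Z (x - y))
        (Measure.dirac 0 + p.conv (renewalMeasure p)) := by
      rw [← Measure.conv_comm (renewalMeasure p) p, ← renewalMeasure_eq]; exact hi x
    rw [hVdef]
    simp only
    conv_lhs => rw [renewalMeasure_eq p, Measure.conv_comm _ p]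
    rw [integral_add_measure hi'.left_of_add_measure hi'.right_of_add_measure, integral_dirac,
      integral_conv hi'.right_of_add_measure]
    simp only [sub_zero, sub_sub]
  have key := eq_zero_of_abs_le_integral hp1 (W := fun x => extend Z x - V x)
    (K := K + L * (∫⁻ y, tilt ε y ∂(renewalMeasure p)).toReal) (fun x => ?_) (fun x => ?_) x
  · exact sub_eq_zero.1 key
  · have h3 := abs_sub (extend Z x) (V x)
    rw [add_mul]
    exact h3.trans (add_le_add (abs_extend_le hK x) (hV x))
  · rw [integral_sub (integrable_comp_sub hp hZ.measurable_extend (abs_extend_le hK) x)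
        (integrable_comp_sub hp hVm hV x), hVeq x, defect]
    refine le_of_eq ?_
    congr 1
    ring

lemma integrable_defect (h : IsSmoothSplitting b p ν f) (hZ : IsRenewalSolution p z Z)
    {η L : ℝ} (hη : 0 < η)
    (hd : ∀ x, |defect p Z x| ≤ L * Real.exp (-(η * |x|))) : Integrable (defect p Z) :=
  have := h.prob
  ((integrable_exp_neg_abs hη).const_mul L).mono' hZ.measurable_defect.aestronglyMeasurable
    (.of_forall hd)

lemma setIntegral_Iio_extend (Z : ℝ → ℝ) (y : ℝ) :
    ∫ x in Iio (0 : ℝ), extend Z (x - y) =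
      (Iic (0 : ℝ)).indicator (fun y => ∫ x in (0 : ℝ)..|y|, Z x) y := by
  rw [← integral_indicator measurableSet_Iio, ← integral_add_right_eq_self _ y]
  by_cases hy : y ≤ 0
  · rw [indicator_of_mem (mem_Iic.2 hy), intervalIntegral.integral_of_le (abs_nonneg _),
      integral_Ioc_eq_integral_Ioo, ← integral_Ico_eq_integral_Ioo,
      ← integral_indicator measurableSet_Ico, abs_of_nonpos hy]
    congr 1 with x
    by_cases hx : x ∈ Ico 0 (-y)
    · rw [indicator_of_mem hx, indicator_of_mem (by simpa using by linarith [hx.2]),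
        add_sub_cancel_right, extend_of_nonneg hx.1]
    · rw [indicator_of_notMem hx]
      by_cases hx' : x + y ∈ Iio 0
      · rw [indicator_of_mem hx', add_sub_cancel_right, extend_of_neg]
        by_contra h0
        exact hx ⟨not_lt.1 h0, by linarith [mem_Iio.1 hx']⟩
      · rw [indicator_of_notMem hx']
  · rw [indicator_of_notMem (by simpa using hy)]
    refine integral_eq_zero_of_ae (.of_forall fun x => ?_)
    by_cases hx' : x + y ∈ Iio 0
    · simp only [indicator_of_mem hx', add_sub_cancel_right, Pi.zero_apply]
      exact extend_of_neg (by linarith [mem_Iio.1 hx', not_le.1 hy])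
    · simp only [indicator_of_notMem hx', Pi.zero_apply]

/-- The limit in the renewal theorem is `1 / μ_p` times the integral of the defect. -/
lemma renewalLimit_eq (h : IsSmoothSplitting b p ν f) (hZ : IsRenewalSolution p z Z) {η L L₂ : ℝ}
    (hη : 0 < η) (hητ : η ≤ b.τ) (hL₂ : ∀ x, 0 ≤ x → |Z x| ≤ L₂ * Real.exp (η * x))
    (hd : ∀ x, |defect p Z x| ≤ L * Real.exp (-(η * |x|))) :
    renewalLimit p z Z = (mean p)⁻¹ * ∫ x, defect p Z x := by
  have := h.prob
  have hη' : |η| ≤ b.τ := by rwa [abs_of_pos hη]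
  have hi := h.integrable_defect hZ hη hd
  have e1 : ∫ x in Ici (0 : ℝ), defect p Z x = ∫ x in Ioi (0 : ℝ), z x := by
    rw [integral_Ici_eq_integral_Ioi]
    exact setIntegral_congr_fun measurableSet_Ioi fun x hx => hZ.defect_eq (le_of_lt hx)
  have hprod : Integrable (Function.uncurry fun x y => extend Z (x - y))
      ((volume.restrict (Iio (0 : ℝ))).prod p) := by
    have h1 : IntegrableOn (fun x : ℝ => L₂ * Real.exp (η * x)) (Iio 0) := by
      refine (Integrable.const_mul ?_ L₂)
      exact ((integrableOn_exp_mul_Iic hη 0).mono_set Iio_subset_Iic_self)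
    refine (Integrable.mul_prod h1 (integrable_tilt (h.lintegral_tilt_lt_top hη'))).mono'
      (hZ.measurable_extend.comp (by fun_prop)).aestronglyMeasurable (.of_forall fun w => ?_)
    simp only [Function.uncurry]
    refine (abs_extend_le hL₂ (w.1 - w.2)).trans (le_of_eq ?_)
    rw [mul_assoc, ← Real.exp_add]
    ring_nf
  have e2 : ∫ x in Iio (0 : ℝ), defect p Z x =
      -∫ y in Iic (0 : ℝ), (∫ x in (0 : ℝ)..|y|, Z x) ∂p := by
    calc ∫ x in Iio (0 : ℝ), defect p Z x
        = ∫ x in Iio (0 : ℝ), -∫ y, extend Z (x - y) ∂p :=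
          setIntegral_congr_fun measurableSet_Iio fun x hx => by
            simp only [defect, extend_of_neg (mem_Iio.1 hx), zero_sub]
      _ = -∫ y, (∫ x in Iio (0 : ℝ), extend Z (x - y)) ∂p := by
          rw [integral_neg, integral_integral_swap hprod]
      _ = _ := by
          simp only [setIntegral_Iio_extend]
          rw [integral_indicator measurableSet_Iic]
  rw [renewalLimit, ← e1, sub_eq_add_neg, ← e2, ← compl_Ici,
    integral_add_compl measurableSet_Ici hi]

end IsSmoothSplitting

/-! ### The rate of convergence -/

namespace IsSmoothSplitting

variable {b : Bounds} {p ν : Measure ℝ} {f : ℝ → ℝ} {z Z : ℝ → ℝ}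

lemma isFiniteMeasure_renewalMeasure_right (h : IsSmoothSplitting b p ν f) :
    IsFiniteMeasure (renewalMeasure ν) := by
  have := h.isFiniteMeasure_right
  have h1 : ν univ < 1 := h.mass_le.trans_lt (by
    rw [ENNReal.ofReal_lt_one]; linarith [b.δ_pos])
  have h2 := renewalMeasure_univ_mul_le ν
  refine ⟨lt_of_le_of_ne le_top fun h3 => ?_⟩
  rw [h3, ENNReal.mul_top (tsub_pos_of_lt h1).ne'] at h2
  exact absurd h2 (by simp)

/-- The density `q_p` is continuous at `0`, where its limits from both sides differ from `1 / μ_p`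
and from `0` by amounts whose sum is at most `A₁`. Hence `A₁` bounds `1 / μ_p`. -/
lemma inv_mean_le (h : IsSmoothSplitting b p ν f) {r a₁ : ℝ}
    (hA : ∀ x > 0, ∀ y > 0, Real.exp (r * x) * |density p ν f x - (mean p)⁻¹| +
      Real.exp (r * y) * density p ν f (-y) ≤ a₁) : (mean p)⁻¹ ≤ a₁ := by
  have hq := h.continuous_density
  have hl : Tendsto (fun x => Real.exp (r * x) * |density p ν f x - (mean p)⁻¹| +
      Real.exp (r * x) * density p ν f (-x)) (𝓝[>] 0)
      (𝓝 (|density p ν f 0 - (mean p)⁻¹| + density p ν f 0)) := by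
    have : Continuous (fun x => Real.exp (r * x) * |density p ν f x - (mean p)⁻¹| +
      Real.exp (r * x) * density p ν f (-x)) := by fun_prop
    have h2 := (this.tendsto 0).mono_left (nhdsWithin_le_nhds (s := Ioi 0))
    simpa using h2
  have h1 : |density p ν f 0 - (mean p)⁻¹| + density p ν f 0 ≤ a₁ :=
    le_of_tendsto hl (eventually_mem_nhdsWithin.mono fun x hx => hA x hx x hx)
  have := neg_abs_le (density p ν f 0 - (mean p)⁻¹)
  linarith

end IsSmoothSplitting

lemma measureReal_compl_zero_le {κ : Measure ℝ} [IsFiniteMeasure κ] {r a₂ : ℝ} (hr : 0 < r)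
    (hA : ∀ x > 0, Real.exp (r * x) * κ.real (Iic (-x) ∪ Ici x) ≤ a₂) :
    κ.real {(0 : ℝ)}ᶜ ≤ a₂ := by
  have hU : ({(0 : ℝ)}ᶜ : Set ℝ) =
      ⋃ n : ℕ, Iic (-(1 / ((n : ℝ) + 1))) ∪ Ici (1 / ((n : ℝ) + 1)) := by
    ext x
    simp only [mem_compl_iff, mem_singleton_iff, mem_iUnion, mem_union, mem_Iic, mem_Ici]
    constructor
    · intro hx
      obtain ⟨n, hn⟩ := exists_nat_one_div_lt (abs_pos.2 hx)
      refine ⟨n, ?_⟩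
      rcases le_abs.1 hn.le with h1 | h1
      · exact Or.inr h1
      · exact Or.inl (by linarith)
    · rintro ⟨n, hn⟩ rfl
      have : 0 < 1 / ((n : ℝ) + 1) := by positivity
      rcases hn with h1 | h1 <;> linarith
  have hmono : Monotone fun n : ℕ => Iic (-(1 / ((n : ℝ) + 1))) ∪ Ici (1 / ((n : ℝ) + 1)) := by
    intro m n hmn
    have : 1 / ((n : ℝ) + 1) ≤ 1 / ((m : ℝ) + 1) := Nat.one_div_le_one_div hmn
    exact union_subset_union (Iic_subset_Iic.2 (by linarith)) (Ici_subset_Ici.2 this)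
  rw [hU]
  refine le_of_tendsto ((ENNReal.tendsto_toReal (measure_ne_top κ _)).comp
    (tendsto_measure_iUnion_atTop hmono)) (.of_forall fun n => ?_)
  have hn : 0 < 1 / ((n : ℝ) + 1) := by positivity
  refine le_trans ?_ (hA _ hn)
  exact le_mul_of_one_le_left ENNReal.toReal_nonneg (Real.one_le_exp (by positivity))

/-- The renewal measure of `ν` charges the complement of `0` at least as much as a first step of
`ν` away from `0` after the returns to `0`. -/
lemma mul_renewalMeasure_zero_le (ν : Measure ℝ) [IsFiniteMeasure ν] :
    ν {(0 : ℝ)}ᶜ * renewalMeasure ν {0} ≤ renewalMeasure ν {(0 : ℝ)}ᶜ := by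
  have h1 : (renewalMeasure ν).conv ν {(0 : ℝ)}ᶜ ≤ renewalMeasure ν {(0 : ℝ)}ᶜ := by
    conv_rhs => rw [renewalMeasure_eq ν]
    rw [Measure.add_apply]
    exact le_add_self
  refine le_trans ?_ h1
  have hm : MeasurableSet ({(0 : ℝ)}ᶜ : Set ℝ) := (measurableSet_singleton 0).compl
  rw [← lintegral_indicator_one hm, ← lintegral_indicator_one hm,
    Measure.lintegral_conv (measurable_one.indicator hm)]
  refine le_trans (le_of_eq ?_) (setLIntegral_le_lintegral {0} _)
  rw [lintegral_singleton]
  simp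

namespace IsSmoothSplitting

variable {b : Bounds} {p ν : Measure ℝ} {f : ℝ → ℝ} {z Z : ℝ → ℝ}

/-- If `N̄_p` has a large atom at `0`, then `p` is concentrated at `0`. -/
lemma compl_zero_mul_atom_le (h : IsSmoothSplitting b p ν f) {a₂ : ℝ}
    (ha : (renewalMeasure ν).real {(0 : ℝ)}ᶜ ≤ a₂) :
    p.real {(0 : ℝ)}ᶜ * (renewalMeasure ν).real {0} ≤ 1 + a₂ := by
  have := h.prob
  have := h.isFiniteMeasure_left
  have := h.isFiniteMeasure_right
  have := h.isFiniteMeasure_renewalMeasure_right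
  have h1 := ENNReal.toReal_mono (measure_ne_top _ _) (mul_renewalMeasure_zero_le ν)
  rw [ENNReal.toReal_mul] at h1
  have h2 := ENNReal.toReal_mono ENNReal.one_ne_top (renewalMeasure_univ_mul_le ν)
  have h3 : ν univ ≤ 1 := h.mass_le.trans (ENNReal.ofReal_le_one.2 (by linarith [b.δ_pos]))
  rw [ENNReal.toReal_mul, ENNReal.toReal_sub_of_le h3 ENNReal.one_ne_top, ENNReal.toReal_one] at h2
  set β := volume.withDensity fun x => ENNReal.ofReal (f x) with hβ
  have h4 : β.real univ + ν.real univ = 1 := by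
    rw [← measureReal_add_apply, ← h.split]; simp
  have h5 : p.real {(0 : ℝ)}ᶜ = β.real {(0 : ℝ)}ᶜ + ν.real {(0 : ℝ)}ᶜ := by
    rw [← measureReal_add_apply, ← h.split]
  have h6 : β.real {(0 : ℝ)}ᶜ ≤ β.real univ := measureReal_mono (subset_univ _)
  have h7 : (renewalMeasure ν).real {0} ≤ (renewalMeasure ν).real univ :=
    measureReal_mono (subset_univ _)
  have h8 : β.real univ * (renewalMeasure ν).real univ ≤ 1 := by
    rw [show β.real univ = 1 - ν.real univ by linarith]; exact h2
  have h9 : β.real {(0 : ℝ)}ᶜ * (renewalMeasure ν).real {0} ≤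
      β.real univ * (renewalMeasure ν).real univ := by gcongr
  have h10 : ν.real {(0 : ℝ)}ᶜ * (renewalMeasure ν).real {0} ≤
    (renewalMeasure ν).real {(0 : ℝ)}ᶜ := h1
  rw [h5, add_mul]
  linarith

lemma integral_compl_zero (p : Measure ℝ) : ∫ y in ({(0 : ℝ)}ᶜ : Set ℝ), y ∂p = mean p := by
  rw [mean]
  exact setIntegral_eq_integral_of_forall_compl_eq_zero fun x hx => by simpa using hx

lemma compl_zero_pos (h : IsSmoothSplitting b p ν f) : 0 < p.real {(0 : ℝ)}ᶜ := by
  have := h.prob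
  refine lt_of_le_of_ne measureReal_nonneg fun h0 => ?_
  have h1 : p {(0 : ℝ)}ᶜ = 0 := (measureReal_eq_zero_iff).1 h0.symm
  have h2 := integral_compl_zero p
  rw [Measure.restrict_eq_zero.2 h1, integral_zero_measure] at h2
  exact h.mean_pos.ne h2

/-- A concentrated `p` with given mean has a large exponential moment: by Jensen's inequality on
the complement of `0`, here in the form of a tangent to the exponential function. -/
lemma mul_exp_le_moment (h : IsSmoothSplitting b p ν f) {η : ℝ} (hη : 0 < η) (hητ : η ≤ b.τ) :
    p.real {(0 : ℝ)}ᶜ * Real.exp (η * mean p / p.real {(0 : ℝ)}ᶜ) ≤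
      (∫⁻ y, absTilt b.τ y ∂p).toReal := by
  have := h.prob
  have hw := h.compl_zero_pos
  set w := p.real {(0 : ℝ)}ᶜ with hwdef
  set t := η * mean p / w with ht
  have e1 : (∫⁻ y, absTilt b.τ y ∂p).toReal = ∫ y, Real.exp (b.τ * |y|) ∂p := by
    rw [integral_eq_lintegral_of_nonneg_ae (.of_forall fun _ => Real.exp_nonneg _) (by fun_prop)]
    rfl
  have hid := h.integrable_id
  have e2 : ∫ y in ({(0 : ℝ)}ᶜ : Set ℝ), Real.exp t * ((1 - t) + η * y) ∂p = w * Real.exp t := by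
    rw [integral_const_mul, integral_add (integrable_const _) (hid.integrableOn.const_mul _),
      integral_const_mul, integral_compl_zero, setIntegral_const, smul_eq_mul, ← hwdef]
    have : w * t = η * mean p := by rw [ht]; field_simp
    linear_combination (-Real.exp t) * this
  rw [e1, ← e2]
  refine le_trans ?_ (setIntegral_le_integral (s := ({(0 : ℝ)}ᶜ : Set ℝ)) h.integrable_exp_abs
    (.of_forall fun _ => Real.exp_nonneg _))
  refine integral_mono ((((integrable_const (1 - t)).add (hid.const_mul η)).const_mul
    (Real.exp t)).integrableOn) h.integrable_exp_abs.integrableOn fun y => ?_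
  have h1 := Real.add_one_le_exp (η * y - t)
  have h2 : η * y ≤ b.τ * |y| := by
    calc η * y ≤ η * |y| := by gcongr; exact le_abs_self y
      _ ≤ _ := by gcongr
  calc Real.exp t * ((1 - t) + η * y) ≤ Real.exp t * Real.exp (η * y - t) := by
        gcongr; linarith
    _ = Real.exp (η * y) := by rw [← Real.exp_add]; ring_nf
    _ ≤ _ := Real.exp_le_exp.2 h2

/-- Up to the contribution of the atom of `N̄_p` at `0`, the solution converges exponentially
fast. -/
lemma abs_sub_sub_atom_le (h : IsSmoothSplitting b p ν f) (hZ : IsRenewalSolution p z Z)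
    (hg : IsSubexp Z) {η L L₂ r a₁ a₂ : ℝ} (hη : 0 < η) (hητ : η ≤ b.τ) (hr : 0 < r)
    (hL₂ : ∀ x, 0 ≤ x → |Z x| ≤ L₂ * Real.exp (η * x))
    (hd : ∀ x, |defect p Z x| ≤ L * Real.exp (-(η * |x|)))
    (hA₁ : ∀ x > 0, ∀ y > 0, Real.exp (r * x) * |density p ν f x - (mean p)⁻¹| +
      Real.exp (r * y) * density p ν f (-y) ≤ a₁)
    (hA₂ : ∀ x > 0, Real.exp (r * x) * (renewalMeasure ν).real (Iic (-x) ∪ Ici x) ≤ a₂)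
    {x : ℝ} (hx : 0 < x) :
    |Z x - renewalLimit p z Z - (renewalMeasure ν).real {0} * z x| ≤
      L * (8 * a₁ / min η r + 2 * a₂) * Real.exp (-((1 / 2 * min η r) * x)) := by
  have := h.prob
  have hfin := h.isFiniteMeasure_renewalMeasure_right
  have hL : 0 ≤ L := by simpa using (abs_nonneg _).trans (hd 0)
  have hμ : (mean p)⁻¹ ≤ a₁ := h.inv_mean_le hA₁
  have hμ0 := h.mean_pos
  have ha₁ : 0 ≤ a₁ := (inv_nonneg.2 hμ0.le).trans hμ
  have hm := hZ.measurable_defect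
  set α := 1 / 2 * min η r with hα
  have hα0 : 0 < α := by have := lt_min hη hr; positivity
  have hαη : 2 * α ≤ η := by rw [hα]; linarith [min_le_left η r]
  have hαr : 2 * α ≤ r := by rw [hα]; linarith [min_le_right η r]
  set N' := renewalMeasure ν with hN'
  set D : ℝ → ℝ := defect p Z with hD
  -- The convolution with the renewal measure splits into two parts.
  set ε := min b.ρ η with hε
  have hε0 : 0 < ε := lt_min b.ρ_pos hη
  have hN := lintegral_tilt_renewalMeasure_lt_top (h.lintegral_tilt_lt_one hε0 (min_le_left _ _))
  have hiN : Integrable (fun y => D (x - y)) (renewalMeasure p) := by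
    refine integrable_comp_sub hN hm (K := L) (fun y => (hd y).trans ?_) x
    gcongr
    exact neg_mul_abs_le hε0.le (min_le_right _ _) y
  have hZx : Z x = (∫ y, density p ν f y * D (x - y)) + ∫ y, D (x - y) ∂N' := by
    rw [← extend_of_nonneg (Z := Z) hx.le, h.extend_eq_integral hZ hg hη hd]
    rw [h.renewalMeasure_eq_add] at hiN
    conv_lhs => rw [h.renewalMeasure_eq_add]
    rw [integral_add_measure hiN.left_of_add_measure hiN.right_of_add_measure,
      integral_withDensity_eq_integral_toReal_smul
        h.continuous_density.measurable.ennreal_ofReal (.of_forall fun _ => ENNReal.ofReal_lt_top)]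
    congr 2 with y
    rw [ENNReal.toReal_ofReal (h.density_nonneg y), smul_eq_mul]
  have hiq : Integrable fun y => density p ν f y * D (x - y) := by
    rw [h.renewalMeasure_eq_add] at hiN
    have h1 := hiN.left_of_add_measure
    rw [integrable_withDensity_iff_integrable_smul'
      h.continuous_density.measurable.ennreal_ofReal
      (.of_forall fun _ => ENNReal.ofReal_lt_top)] at h1
    refine h1.congr (.of_forall fun y => ?_)
    simp only
    rw [ENNReal.toReal_ofReal (h.density_nonneg y), smul_eq_mul]
  have hiD : Integrable fun y => D (x - y) := (h.integrable_defect hZ hη hd).comp_sub_left x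
  have hiN' : Integrable (fun y => D (x - y)) N' := by
    rw [h.renewalMeasure_eq_add] at hiN
    exact hiN.right_of_add_measure
  have hu : renewalLimit p z Z = ∫ y, (mean p)⁻¹ * D (x - y) := by
    rw [h.renewalLimit_eq hZ hη hητ hL₂ hd, integral_const_mul, integral_sub_left_eq_self]
  have hatom : ∫ y, D (x - y) ∂N' =
      N'.real {0} * z x + ∫ y in ({(0 : ℝ)}ᶜ : Set ℝ), D (x - y) ∂N' := by
    rw [← integral_add_compl (measurableSet_singleton (0 : ℝ)) hiN', integral_singleton,
      sub_zero, hD, hZ.defect_eq hx.le, smul_eq_mul]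
  have hdecomp : Z x - renewalLimit p z Z - N'.real {0} * z x =
      (∫ y, (density p ν f y - (mean p)⁻¹) * D (x - y)) +
        ∫ y in ({(0 : ℝ)}ᶜ : Set ℝ), D (x - y) ∂N' := by
    simp only [sub_mul]
    rw [integral_sub hiq (hiD.const_mul _), ← hu, hZx, hatom]
    ring
  -- The smooth part.
  have hq : ∀ y : ℝ, y ≠ 0 → |(density p ν f y - (mean p)⁻¹) * D (x - y)| ≤
      2 * a₁ * L * Real.exp (-(α * x)) * Real.exp (-(α * |y|)) := by
    intro y hy
    rw [abs_mul]
    rcases lt_or_gt_of_ne hy with hy | hy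
    · have h1 : density p ν f y ≤ a₁ := by
        have h2 := hA₁ (-y) (by linarith) (-y) (by linarith)
        rw [neg_neg] at h2
        have h3 : density p ν f y ≤ Real.exp (r * -y) * density p ν f y :=
          le_mul_of_one_le_left (h.density_nonneg y) (Real.one_le_exp (by nlinarith))
        have h4 : 0 ≤ Real.exp (r * -y) * |density p ν f (-y) - (mean p)⁻¹| := by positivity
        linarith
      have h2 : |density p ν f y - (mean p)⁻¹| ≤ 2 * a₁ := by
        have := h.density_nonneg y
        have := inv_nonneg.2 hμ0.le
        rw [abs_le]; constructor <;> linarith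
      have h3 : |x - y| = x + |y| := by rw [abs_of_neg hy, abs_of_pos (by linarith)]; ring
      have h4 := hd (x - y)
      rw [h3] at h4
      rw [mul_assoc (2 * a₁ * L), ← Real.exp_add, mul_assoc (2 * a₁)]
      refine mul_le_mul h2 (h4.trans ?_) (abs_nonneg _) (by positivity)
      gcongr
      have h5 : α * (x + |y|) ≤ η * (x + |y|) := by gcongr; linarith
      linarith
    · have h1 : |density p ν f y - (mean p)⁻¹| ≤ a₁ * Real.exp (-(r * y)) := by
        have h2 := hA₁ y hy y hy
        have h4 : 0 ≤ Real.exp (r * y) * density p ν f (-y) :=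
          mul_nonneg (Real.exp_nonneg _) (h.density_nonneg _)
        rw [Real.exp_neg, ← div_eq_mul_inv, le_div_iff₀' (Real.exp_pos _)]
        linarith
      have h3 := hd (x - y)
      calc _ ≤ (a₁ * Real.exp (-(r * y))) * (L * Real.exp (-(η * |x - y|))) := by gcongr
        _ = a₁ * L * Real.exp (-(r * y) + -(η * |x - y|)) := by rw [Real.exp_add]; ring
        _ ≤ 2 * a₁ * L * Real.exp (-(α * x) + -(α * |y|)) := by
            have : 0 ≤ a₁ * L := mul_nonneg ha₁ hL
            have h6 : a₁ * L ≤ 2 * a₁ * L := by linarith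
            gcongr ?_ * Real.exp ?_
            rw [abs_of_pos hy]
            have h7 : 2 * α * |x - y| ≤ η * |x - y| := by gcongr
            have h8 : 2 * α * y ≤ r * y := by gcongr
            have h9 : α * (x - y) ≤ α * |x - y| := by gcongr; exact le_abs_self _
            have h10 : 0 ≤ α * |x - y| := by positivity
            linarith
        _ = _ := by rw [Real.exp_add]; ring
  have hI₁ : |∫ y, (density p ν f y - (mean p)⁻¹) * D (x - y)| ≤
      L * (8 * a₁ / min η r) * Real.exp (-(α * x)) := by
    rw [← Real.norm_eq_abs]
    refine (norm_integral_le_of_norm_le ((integrable_exp_neg_abs hα0).const_mul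
      (2 * a₁ * L * Real.exp (-(α * x)))) ?_).trans (le_of_eq ?_)
    · filter_upwards [compl_mem_ae_iff.2 (measure_singleton (0 : ℝ))] with y hy
      exact hq y hy
    · rw [integral_const_mul, integral_exp_neg_abs hα0, hα]
      have := lt_min hη hr
      field_simp
      ring
  -- The part without density, away from its atom at `0`.
  have hI₂ : |∫ y in ({(0 : ℝ)}ᶜ : Set ℝ), D (x - y) ∂N'| ≤
      L * (2 * a₂) * Real.exp (-(α * x)) := by
    set S : Set ℝ := Iic (-(x / 2)) ∪ Ici (x / 2) with hS
    have hSm : MeasurableSet S := measurableSet_Iic.union measurableSet_Ici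
    have hpt : ∀ y, |D (x - y)| ≤ L * Real.exp (-(α * x)) + S.indicator (fun _ => L) y := by
      intro y
      by_cases hy : y ∈ S
      · rw [indicator_of_mem hy]
        have h1 : L * Real.exp (-(η * |x - y|)) ≤ L * 1 := by
          gcongr
          exact Real.exp_le_one_iff.2 (neg_nonpos.2 (by positivity))
        have h2 : 0 ≤ L * Real.exp (-(α * x)) := by positivity
        linarith [hd (x - y)]
      · rw [indicator_of_notMem hy, add_zero]
        refine (hd (x - y)).trans ?_
        refine mul_le_mul_of_nonneg_left (Real.exp_le_exp.2 (neg_le_neg ?_)) hL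
        have h1 : y < x / 2 := by
          by_contra h0
          exact hy (Or.inr (by simpa using h0))
        calc α * x ≤ η / 2 * x := by gcongr; linarith
          _ = η * (x / 2) := by ring
          _ ≤ η * |x - y| := by
            gcongr
            exact le_trans (by linarith) (le_abs_self _)
    have h1 : N'.real {(0 : ℝ)}ᶜ ≤ a₂ := measureReal_compl_zero_le hr hA₂
    have h2 : N'.real S ≤ a₂ * Real.exp (-(α * x)) := by
      have h3 := hA₂ (x / 2) (by linarith)
      have h4 : 0 ≤ a₂ := measureReal_nonneg.trans h1
      calc N'.real S = Real.exp (-(r * (x / 2))) * (Real.exp (r * (x / 2)) * N'.real S) := by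
            rw [← mul_assoc, ← Real.exp_add]; simp
        _ ≤ Real.exp (-(r * (x / 2))) * a₂ := by gcongr
        _ ≤ Real.exp (-(α * x)) * a₂ := by
            refine mul_le_mul_of_nonneg_right (Real.exp_le_exp.2 (neg_le_neg ?_)) h4
            calc α * x ≤ r / 2 * x := by gcongr; linarith
              _ = r * (x / 2) := by ring
        _ = _ := mul_comm _ _
    have hii : Integrable (S.indicator fun _ => L) N' := (integrable_const L).indicator hSm
    rw [← Real.norm_eq_abs]
    calc ‖∫ y in ({(0 : ℝ)}ᶜ : Set ℝ), D (x - y) ∂N'‖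
        ≤ ∫ y in ({(0 : ℝ)}ᶜ : Set ℝ), (L * Real.exp (-(α * x)) + S.indicator (fun _ => L) y) ∂N' :=
          norm_integral_le_of_norm_le ((integrable_const (L * Real.exp (-(α * x)))).add
            hii.integrableOn) (.of_forall hpt)
      _ = N'.real {(0 : ℝ)}ᶜ * (L * Real.exp (-(α * x))) +
            ∫ y in ({(0 : ℝ)}ᶜ : Set ℝ), S.indicator (fun _ => L) y ∂N' := by
          rw [integral_add (integrable_const _) hii.integrableOn, setIntegral_const, smul_eq_mul]
      _ ≤ N'.real {(0 : ℝ)}ᶜ * (L * Real.exp (-(α * x))) + ∫ y, S.indicator (fun _ => L) y ∂N' := by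
          refine add_le_add_right ?_ _
          exact setIntegral_le_integral hii (.of_forall fun y => indicator_nonneg (fun _ _ => hL) y)
      _ = N'.real {(0 : ℝ)}ᶜ * (L * Real.exp (-(α * x))) + N'.real S * L := by
          rw [integral_indicator hSm, setIntegral_const, smul_eq_mul]
      _ ≤ a₂ * (L * Real.exp (-(α * x))) + a₂ * Real.exp (-(α * x)) * L := by gcongr
      _ = _ := by ring
  rw [hdecomp]
  refine (abs_add_le _ _).trans ((add_le_add hI₁ hI₂).trans (le_of_eq ?_))
  ring

end IsSmoothSplitting

/-- The constant in the exponential rate, as a function of `(a₁, a₂, L, η, r)`. -/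
noncomputable def rateConst (w : ℝ × ℝ × ℝ × ℝ × ℝ) : ℝ :=
  w.2.2.1 * (8 * w.1 / min w.2.2.2.1 w.2.2.2.2 + 2 * w.2.1 + 4 * w.1 / w.2.2.2.1 +
    8 * (1 + w.2.1) * w.1 / w.2.2.2.1)

lemma continuousOn_rateConst :
    ContinuousOn rateConst (Ici 0 ×ˢ Ici 0 ×ˢ Ici 0 ×ˢ Ioi 0 ×ˢ Ioi 0) := by
  have h1 : ∀ w ∈ (Ici 0 ×ˢ Ici 0 ×ˢ Ici 0 ×ˢ Ioi 0 ×ˢ Ioi 0 : Set (ℝ × ℝ × ℝ × ℝ × ℝ)),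
      w.2.2.2.1 ≠ 0 := fun w hw => (mem_Ioi.1 hw.2.2.2.1).ne'
  have h2 : ∀ w ∈ (Ici 0 ×ˢ Ici 0 ×ˢ Ici 0 ×ˢ Ioi 0 ×ˢ Ioi 0 : Set (ℝ × ℝ × ℝ × ℝ × ℝ)),
      min w.2.2.2.1 w.2.2.2.2 ≠ 0 := fun w hw => (lt_min hw.2.2.2.1 hw.2.2.2.2).ne'
  unfold rateConst
  refine ContinuousOn.mul (by fun_prop) (ContinuousOn.add (ContinuousOn.add (ContinuousOn.add ?_
    (by fun_prop)) ?_) ?_)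
  · exact ContinuousOn.div (by fun_prop) (by fun_prop) h2
  · exact ContinuousOn.div (by fun_prop) (by fun_prop) h1
  · exact ContinuousOn.div (by fun_prop) (by fun_prop) h1

namespace IsSmoothSplitting

variable {b : Bounds} {p ν : Measure ℝ} {f : ℝ → ℝ} {z Z : ℝ → ℝ}

/-- The exponential rate of convergence. The contribution of the atom of `N̄_p` at `0`, of mass `k`,
is `k z(x)`, and `k` is not bounded in terms of `A₁` and `A₂`.
But `k` is at most `(1 + A₂) / w`, where
`w` is the mass of `p` outside `0`, and the exponential moment of `p` is exponentially large in
`1 / w`. The bound for `L₂ M_τ` thus makes `Z` very small up to `x₀ = μ_p / (4 w)`; so is then the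
limit, and `k z(x)` is small from `x₀` on. -/
lemma exp_mul_abs_sub_le (h : IsSmoothSplitting b p ν f) (hZ : IsRenewalSolution p z Z)
    (hg : IsSubexp Z) {η L L₂ r a₁ a₂ : ℝ} (hη : 0 < η) (hητ : η ≤ b.τ) (hr : 0 < r)
    (hz : ∀ x, 0 ≤ x → |z x| ≤ L * Real.exp (-(η * x)))
    (hL₂ : ∀ x, 0 ≤ x → |Z x| ≤ L₂ * Real.exp (η * x))
    (hL : L₂ * (∫⁻ y, absTilt b.τ y ∂p).toReal ≤ L)
    (hA₁ : ∀ x > 0, ∀ y > 0, Real.exp (r * x) * |density p ν f x - (mean p)⁻¹| +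
      Real.exp (r * y) * density p ν f (-y) ≤ a₁)
    (hA₂ : ∀ x > 0, Real.exp (r * x) * (renewalMeasure ν).real (Iic (-x) ∪ Ici x) ≤ a₂)
    {x : ℝ} (hx : 0 < x) :
    Real.exp ((1 / 2 * min η r) * x) * |Z x - renewalLimit p z Z| ≤
      rateConst (a₁, a₂, L, η, r) := by
  have hfin := h.isFiniteMeasure_renewalMeasure_right
  have hmain := fun x (hx : 0 < x) => h.abs_sub_sub_atom_le hZ hg hη hητ hr hL₂
    (h.abs_defect_le hZ hη hητ hz hL₂ hL) hA₁ hA₂ (x := x) hx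
  have hμ : (mean p)⁻¹ ≤ a₁ := h.inv_mean_le hA₁
  have hμ0 := h.mean_pos
  have hw := h.compl_zero_pos
  have hwk := h.compl_zero_mul_atom_le (measureReal_compl_zero_le hr hA₂)
  have hM := h.mul_exp_le_moment hη hητ
  have hL0 : 0 ≤ L := by simpa using (abs_nonneg _).trans (hz 0 le_rfl)
  have hL20 : 0 ≤ L₂ := by simpa using (abs_nonneg _).trans (hL₂ 0 le_rfl)
  have hk : 0 ≤ (renewalMeasure ν).real {0} := measureReal_nonneg
  have ha₂ : 0 ≤ a₂ := measureReal_nonneg.trans (measureReal_compl_zero_le hr hA₂)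
  set α := 1 / 2 * min η r with hα
  have hα0 : 0 < α := by have := lt_min hη hr; positivity
  have hαη : 2 * α ≤ η := by rw [hα]; linarith [min_le_left η r]
  set k := (renewalMeasure ν).real {0}
  set w := p.real {(0 : ℝ)}ᶜ
  set u := renewalLimit p z Z
  set C₁ := L * (8 * a₁ / min η r + 2 * a₂) with hC₁
  set x₀ := mean p / (4 * w) with hx₀
  have hx₀p : 0 < x₀ := by positivity
  set E := 4 * L * a₁ / η with hE
  set E' := 8 * L * (1 + a₂) * a₁ / η with hE'
  -- `Z` is small up to `x₀`.
  have hZs : ∀ x, 0 ≤ x → x ≤ x₀ → |Z x| ≤ E / 2 * Real.exp (-(η * x₀)) := by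
    intro x h0 h1
    have e1 : η * mean p / w = 4 * (η * x₀) := by rw [hx₀]; field_simp
    rw [e1] at hM
    have e2 : w * (2 * (η * x₀)) * Real.exp (2 * (η * x₀)) ≤ w * Real.exp (4 * (η * x₀)) := by
      have e3 : 2 * (η * x₀) ≤ Real.exp (2 * (η * x₀)) := by
        linarith [Real.add_one_le_exp (2 * (η * x₀))]
      rw [show 4 * (η * x₀) = 2 * (η * x₀) + 2 * (η * x₀) by ring, Real.exp_add,
        ← mul_assoc w (Real.exp _)]
      gcongr
    have e3 : w * (2 * (η * x₀)) = η * mean p / 2 := by rw [hx₀]; field_simp; ring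
    rw [e3] at e2
    have e4 : L₂ * (η * mean p / 2 * Real.exp (2 * (η * x₀))) ≤ L :=
      (mul_le_mul_of_nonneg_left (e2.trans hM) hL20).trans hL
    have e5 : L₂ ≤ 2 * L * (mean p)⁻¹ / η * Real.exp (-(2 * (η * x₀))) := by
      rw [Real.exp_neg, ← div_eq_mul_inv, le_div_iff₀ (Real.exp_pos _)]
      calc L₂ * Real.exp (2 * (η * x₀))
          = (L₂ * (η * mean p / 2 * Real.exp (2 * (η * x₀)))) * (2 * (mean p)⁻¹ / η) := by
            field_simp
        _ ≤ L * (2 * (mean p)⁻¹ / η) := by gcongr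
        _ = _ := by ring
    calc |Z x| ≤ L₂ * Real.exp (η * x) := hL₂ x h0
      _ ≤ (2 * L * (mean p)⁻¹ / η * Real.exp (-(2 * (η * x₀)))) * Real.exp (η * x₀) := by gcongr
      _ = 2 * L * (mean p)⁻¹ / η * Real.exp (-(η * x₀)) := by
          rw [mul_assoc, ← Real.exp_add]; ring_nf
      _ ≤ 2 * L * a₁ / η * Real.exp (-(η * x₀)) := by gcongr
      _ = _ := by rw [hE]; ring
  -- The contribution of the atom is small from `x₀` on.
  have hkz : ∀ x, x₀ ≤ x → Real.exp (α * x) * (k * |z x|) ≤ E' := by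
    intro x h1
    have h0 : 0 ≤ x := hx₀p.le.trans h1
    have e1 : Real.exp (-(η * x₀ / 2)) ≤ 2 / (η * x₀) := by
      rw [Real.exp_neg, inv_le_comm₀ (Real.exp_pos _) (by positivity), inv_div]
      linarith [Real.add_one_le_exp (η * x₀ / 2)]
    have e2 : k ≤ (1 + a₂) / w := by rw [le_div_iff₀ hw]; linarith
    calc Real.exp (α * x) * (k * |z x|) ≤ Real.exp (α * x) * (k * (L * Real.exp (-(η * x)))) := by
          gcongr; exact hz x h0
      _ = k * L * Real.exp (α * x + -(η * x)) := by rw [Real.exp_add]; ring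
      _ ≤ k * L * Real.exp (-(η * x₀ / 2)) := by
          gcongr
          have e3 : α * x ≤ η / 2 * x := by gcongr; linarith
          have e4 : η / 2 * x₀ ≤ η / 2 * x := by gcongr
          linarith
      _ ≤ (1 + a₂) / w * L * (2 / (η * x₀)) := by gcongr
      _ = 8 * L * (1 + a₂) * (mean p)⁻¹ / η := by rw [hx₀]; field_simp; ring
      _ ≤ E' := by rw [hE']; gcongr
  have hexp : ∀ x, Real.exp (α * x) * Real.exp (-(α * x)) = 1 := fun x => by
    rw [← Real.exp_add]; simp
  have hrate : rateConst (a₁, a₂, L, η, r) = C₁ + E + E' := by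
    rw [rateConst, hC₁, hE, hE']; ring
  have ha₁ : 0 ≤ a₁ := (inv_nonneg.2 hμ0.le).trans hμ
  have hE0 : 0 ≤ E := by positivity
  have hmain' : ∀ x, 0 < x → Real.exp (α * x) * |Z x - u - k * z x| ≤ C₁ := fun x hx =>
    (mul_le_mul_of_nonneg_left (hmain x hx) (Real.exp_nonneg _)).trans (le_of_eq (by
      rw [mul_comm C₁, ← mul_assoc, hexp, one_mul]))
  rw [hrate]
  rcases le_total x₀ x with hxx | hxx
  · have e1 : |Z x - u| ≤ |Z x - u - k * z x| + k * |z x| := by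
      have := abs_add_le (Z x - u - k * z x) (k * z x)
      rwa [sub_add_cancel, abs_mul, abs_of_nonneg hk] at this
    calc _ ≤ Real.exp (α * x) * (|Z x - u - k * z x| + k * |z x|) := by gcongr
      _ ≤ _ := by
        rw [mul_add]
        linarith [hmain' x hx, hkz x hxx]
  · have e1 : |Z x - u| ≤ |Z x| + (|Z x₀| + (|Z x₀ - u - k * z x₀| + k * |z x₀|)) := by
      have t1 := abs_sub (Z x) u
      have t2 := abs_sub (Z x₀) ((Z x₀ - u - k * z x₀) + k * z x₀)
      have t3 := abs_add_le (Z x₀ - u - k * z x₀) (k * z x₀)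
      rw [show Z x₀ - (Z x₀ - u - k * z x₀ + k * z x₀) = u by ring] at t2
      rw [abs_mul k, abs_of_nonneg hk] at t3
      linarith
    have hZs' : ∀ y, 0 ≤ y → y ≤ x₀ → Real.exp (α * x₀) * |Z y| ≤ E / 2 := by
      intro y h0 h1
      calc _ ≤ Real.exp (α * x₀) * (E / 2 * Real.exp (-(η * x₀))) := by gcongr; exact hZs y h0 h1
        _ = E / 2 * Real.exp (α * x₀ + -(η * x₀)) := by rw [Real.exp_add]; ring
        _ ≤ E / 2 * 1 := by
            gcongr
            refine Real.exp_le_one_iff.2 ?_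
            have : α * x₀ ≤ η * x₀ := by gcongr; linarith
            linarith
        _ = _ := mul_one _
    calc _ ≤ Real.exp (α * x₀) * |Z x - u| := by gcongr
      _ ≤ Real.exp (α * x₀) * (|Z x| + (|Z x₀| + (|Z x₀ - u - k * z x₀| + k * |z x₀|))) := by gcongr
      _ ≤ _ := by
        rw [mul_add, mul_add, mul_add]
        linarith [hmain' x₀ hx₀p, hkz x₀ le_rfl, hZs' x hx.le hxx, hZs' x₀ hx₀p.le le_rfl]

end IsSmoothSplitting

/-! ### Uniform families -/

variable {ι : Type*}

lemma abs_le_of_expSup_lt_top {s : ℝ} {g : ι → ℝ → ℝ} (h : expSup s g < ∞) (i : ι) {x : ℝ}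
    (hx : 0 ≤ x) : |g i x| ≤ (expSup s g).toReal * Real.exp (-(s * x)) := by
  have h1 : ENNReal.ofReal (Real.exp (s * x) * |g i x|) ≤ expSup s g := by
    refine le_trans ?_ (le_iSup _ i)
    exact le_iSup₂_of_le x (mem_Ici.2 hx) le_rfl
  have h2 := (ENNReal.ofReal_le_iff_le_toReal h.ne).1 h1
  rw [Real.exp_neg, ← div_eq_mul_inv, le_div_iff₀ (Real.exp_pos _)]
  linarith

lemma isSubexp_of_isSubexpSolution {p : ι → Measure ℝ} {z Z : ι → ℝ → ℝ}
    (h : IsSubexpSolution p z Z) (i : ι) : IsSubexp (Z i) := fun ε hε =>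
  ⟨_, fun x hx => by simpa using abs_le_of_expSup_lt_top (h.2 ε hε) i hx⟩

namespace IsUniformFamily

variable {p : ι → Measure ℝ} {lam : ι → ℝ} {φ : ι → ℝ → ℝ} {Ψ : ι → Measure ℝ} {τ T : ℝ}

/-- A uniform family consists of smooth splittings with common bounds. -/
lemma exists_bounds (h : IsUniformFamily p lam φ Ψ τ T) : ∃ b : Bounds, b.τ = τ ∧
    ∀ i, IsSmoothSplitting b (p i) (ENNReal.ofReal (lam i) • Ψ i)
      (fun x => (1 - lam i) * φ i x) := by
  obtain ⟨m, hm, hmean⟩ := h.mean_pos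
  obtain ⟨γ, hγ, hlam⟩ := h.lam_le
  obtain ⟨B, hB⟩ := h.phi_deriv_two
  refine ⟨⟨m, τ, T, 1 - max γ 0, (expMoment p τ).toReal + 1, max B 1, hm, h.tau_pos, h.T_pos,
    by simp [hγ], by simp, by positivity, by positivity⟩, rfl, fun i => ?_⟩
  have hi0 := (h.lam_mem i).1
  have hi1 := (h.lam_mem i).2
  have := h.prob_right i
  refine ⟨h.prob i, ?_, hmean i, ?_, fun x => mul_nonneg (by linarith) (h.phi_nonneg i x),
    contDiff_const.mul (h.phi_contDiff i), ?_, ?_, ?_⟩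
  · rw [h.mixture i]
    congr 1
    rw [← withDensity_smul _ (h.phi_contDiff i).continuous.measurable.ennreal_ofReal]
    congr 1 with x
    rw [Pi.smul_apply, smul_eq_mul, ENNReal.ofReal_mul (by linarith)]
  · refine (le_iSup (fun i => ∫⁻ x, absTilt τ x ∂(p i)) i).trans ?_
    change expMoment p τ ≤ _
    rw [ENNReal.le_ofReal_iff_toReal_le h.expMoment_lt_top.ne (by positivity)]
    linarith
  · exact (tsupport_mul_subset_right (f := fun _ => 1 - lam i) (g := φ i)).trans
      (h.phi_tsupport i)
  · have hc := (h.phi_contDiff i).continuous_iteratedDeriv 2 le_rfl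
    have hT := h.T_pos
    refine le_trans (intervalIntegral.integral_mono_on (by linarith) ?_
      (hc.abs.intervalIntegrable _ _) fun x _ => ?_) ((hB i).trans (le_max_left _ _))
    · refine Continuous.intervalIntegrable ?_ _ _
      exact ((contDiff_const.mul (h.phi_contDiff i)).continuous_iteratedDeriv 2 le_rfl).abs
    · rw [iteratedDeriv_const_mul_field, abs_mul, abs_of_pos (by linarith)]
      exact mul_le_of_le_one_left (abs_nonneg _) (by linarith)
  · simp only [Measure.smul_apply, measure_univ, smul_eq_mul, mul_one, sub_sub_cancel]
    exact ENNReal.ofReal_le_ofReal ((hlam i).trans (le_max_left _ _))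

lemma renewalDensity_eq (h : IsUniformFamily p lam φ Ψ τ T) (i : ι) :
    renewalDensity (p i) (lam i) (φ i) (Ψ i) =
      density (p i) (ENNReal.ofReal (lam i) • Ψ i) (fun x => (1 - lam i) * φ i x) := by
  have := h.prob_right i
  ext x
  rw [renewalDensity, density, integral_const_mul, finitePart_eq, kernelMeasure]

lemma A₁_lt_top (h : IsUniformFamily p lam φ Ψ τ T) {b : Bounds}
    (hb : ∀ i, IsSmoothSplitting b (p i) (ENNReal.ofReal (lam i) • Ψ i)
      (fun x => (1 - lam i) * φ i x)) {r₀ c r : ℝ} (ha : IsAdmissible b r₀ c)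
    (hr : r ∈ Ioo 0 r₀) : A₁ p lam φ Ψ r < ∞ := by
  have hB := b.B_pos
  have hT := b.T_pos
  refine ENNReal.add_lt_top.2 ⟨lt_of_le_of_lt (b := ENNReal.ofReal (b.C c r + 1 / b.m)) ?_
    ENNReal.ofReal_lt_top, lt_of_le_of_lt (b := ENNReal.ofReal
      (2 * b.T * b.B * Real.exp (r * b.T) * (b.K r * b.K r).toReal)) ?_ ENNReal.ofReal_lt_top⟩
  · refine iSup_le fun i => iSup₂_le fun x hx => ENNReal.ofReal_le_ofReal ?_
    rw [h.renewalDensity_eq]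
    exact (hb i).abs_density_sub_le ha hr.1 hr.2 hx
  · refine iSup_le fun i => iSup₂_le fun x hx => ENNReal.ofReal_le_ofReal ?_
    rw [h.renewalDensity_eq]
    calc _ ≤ Real.exp (r * x) *
          (2 * b.T * b.B * Real.exp (r * (-x + b.T)) * (b.K r * b.K r).toReal) := by
          gcongr
          exact (hb i).density_le hr.1 (hr.2.le.trans ha.le_ρ) (-x)
      _ = 2 * b.T * b.B * Real.exp (r * x + r * (-x + b.T)) * (b.K r * b.K r).toReal := by
          rw [Real.exp_add]; ring
      _ = _ := by ring_nf

lemma A₂_lt_top (h : IsUniformFamily p lam φ Ψ τ T) {b : Bounds}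
    (hb : ∀ i, IsSmoothSplitting b (p i) (ENNReal.ofReal (lam i) • Ψ i)
      (fun x => (1 - lam i) * φ i x)) {r₀ c r : ℝ} (ha : IsAdmissible b r₀ c)
    (hr : r ∈ Ioo 0 r₀) : A₂ lam Ψ r < ∞ := by
  have hM := b.M_pos
  have hτ := b.τ_pos
  refine lt_of_le_of_lt (b := (1 - ENNReal.ofReal (1 - b.δ / 2))⁻¹) ?_ ?_
  · refine iSup_le fun i => iSup₂_le fun x hx => ?_
    have := h.prob_right i
    have := (hb i).isFiniteMeasure_right
    have hx0 : 0 < x := hx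
    have hm : MeasurableSet (Iic (-x) ∪ Ici x) := measurableSet_Iic.union measurableSet_Ici
    rw [finitePart_eq]
    calc _ = ∫⁻ _ in Iic (-x) ∪ Ici x, ENNReal.ofReal (Real.exp (r * x))
          ∂(renewalMeasure (ENNReal.ofReal (lam i) • Ψ i)) := by rw [setLIntegral_const]
      _ ≤ ∫⁻ y in Iic (-x) ∪ Ici x, absTilt r y
          ∂(renewalMeasure (ENNReal.ofReal (lam i) • Ψ i)) := by
          refine setLIntegral_mono (measurable_absTilt r) fun y hy => ?_
          refine ENNReal.ofReal_le_ofReal (Real.exp_le_exp.2 (mul_le_mul_of_nonneg_left ?_ hr.1.le))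
          rcases hy with hy | hy
          · exact le_abs.2 (Or.inr (by linarith [mem_Iic.1 hy]))
          · exact le_abs.2 (Or.inl hy)
      _ ≤ ∫⁻ y, absTilt r y ∂(renewalMeasure (ENNReal.ofReal (lam i) • Ψ i)) :=
          setLIntegral_le_lintegral _ _
      _ ≤ (1 - ∫⁻ y, absTilt r y ∂(ENNReal.ofReal (lam i) • Ψ i))⁻¹ :=
          lintegral_renewalMeasure_le (measurable_absTilt r) (absTilt_add_le hr.1.le)
            (by simp [absTilt]) _
      _ ≤ _ := by
          gcongr
          refine (hb i).lintegral_absTilt_right_le hr.1.le (hr.2.le.trans ha.le_τ) ?_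
          refine le_trans ?_ ha.mul_le
          gcongr
          exact hr.2.le
  · have h1 : ENNReal.ofReal (1 - b.δ / 2) < 1 := by
      rw [ENNReal.ofReal_lt_one]; linarith [b.δ_pos]
    rw [ENNReal.inv_lt_top]
    exact tsub_pos_of_lt h1

lemma add_le_toReal_A₁ (h : IsUniformFamily p lam φ Ψ τ T) {r : ℝ} (hA : A₁ p lam φ Ψ r < ∞)
    (i : ι) {x y : ℝ} (hx : 0 < x) (hy : 0 < y) :
    Real.exp (r * x) * |density (p i) (ENNReal.ofReal (lam i) • Ψ i)
        (fun x => (1 - lam i) * φ i x) x - (mean (p i))⁻¹| +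
      Real.exp (r * y) * density (p i) (ENNReal.ofReal (lam i) • Ψ i)
        (fun x => (1 - lam i) * φ i x) (-y) ≤ (A₁ p lam φ Ψ r).toReal := by
  rw [← ENNReal.ofReal_le_iff_le_toReal hA.ne, ← h.renewalDensity_eq]
  refine ENNReal.ofReal_add_le.trans (add_le_add ?_ ?_)
  · exact le_iSup_of_le i (le_iSup₂_of_le x (mem_Ioi.2 hx) le_rfl)
  · exact le_iSup_of_le i (le_iSup₂_of_le y (mem_Ioi.2 hy) le_rfl)

lemma mul_le_toReal_A₂ (h : IsUniformFamily p lam φ Ψ τ T) {r : ℝ} (hA : A₂ lam Ψ r < ∞)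
    (i : ι) {x : ℝ} (hx : 0 < x) :
    Real.exp (r * x) * (renewalMeasure (ENNReal.ofReal (lam i) • Ψ i)).real (Iic (-x) ∪ Ici x) ≤
      (A₂ lam Ψ r).toReal := by
  have := h.prob_right i
  have h1 : ENNReal.ofReal (Real.exp (r * x)) * finitePart (lam i) (Ψ i) (Iic (-x) ∪ Ici x) ≤
      A₂ lam Ψ r := le_iSup_of_le i (le_iSup₂_of_le x (mem_Ioi.2 hx) le_rfl)
  have h2 := ENNReal.toReal_mono hA.ne h1
  rwa [ENNReal.toReal_mul, ENNReal.toReal_ofReal (Real.exp_nonneg _), finitePart_eq] at h2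

/-- The rate of convergence for members of a uniform family. -/
lemma exp_mul_abs_sub_le (h : IsUniformFamily p lam φ Ψ τ T) {b : Bounds} (hbτ : b.τ = τ)
    (hb : ∀ i, IsSmoothSplitting b (p i) (ENNReal.ofReal (lam i) • Ψ i)
      (fun x => (1 - lam i) * φ i x)) {r : ℝ} (hr : 0 < r)
    (hA₁ : A₁ p lam φ Ψ r < ∞) (hA₂ : A₂ lam Ψ r < ∞) {η : ℝ} {z Z : ι → ℝ → ℝ} (hη : η ∈ Ioo 0 τ)
    (hz : expSup η z < ∞) (hZ : IsSubexpSolution p z Z) (i : ι) {x : ℝ} (hx : 0 < x) :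
    Real.exp ((1 / 2 * min η r) * x) * |Z i x - renewalLimit (p i) (z i) (Z i)| ≤
      rateConst ((A₁ p lam φ Ψ r).toReal, (A₂ lam Ψ r).toReal,
        (max (expSup η z) (expSup (-η) Z * expMoment p τ)).toReal, η, r) := by
  have hL₂ := hZ.2 η hη.1
  have hmax : max (expSup η z) (expSup (-η) Z * expMoment p τ) ≠ ∞ :=
    (max_lt hz (ENNReal.mul_lt_top hL₂ h.expMoment_lt_top)).ne
  refine (hb i).exp_mul_abs_sub_le (hZ.1 i) (isSubexp_of_isSubexpSolution hZ i)
    (L₂ := (expSup (-η) Z).toReal) hη.1 (hbτ ▸ hη.2.le) hr (fun y hy => ?_) (fun y hy => ?_) ?_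
    (fun x hx y hy => h.add_le_toReal_A₁ hA₁ i hx hy) (fun x hx => h.mul_le_toReal_A₂ hA₂ i hx) hx
  · refine (abs_le_of_expSup_lt_top hz i hy).trans ?_
    exact mul_le_mul_of_nonneg_right (ENNReal.toReal_mono hmax (le_max_left _ _))
      (Real.exp_nonneg _)
  · simpa using abs_le_of_expSup_lt_top hL₂ i hy
  · rw [← ENNReal.toReal_mul, hbτ]
    refine ENNReal.toReal_mono hmax (le_trans ?_ (le_max_right _ _))
    gcongr
    exact le_iSup (fun i => ∫⁻ x, absTilt τ x ∂(p i)) i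

end IsUniformFamily

end UniformRenewal

open UniformRenewal in
theorem corollary1p2 :
    ∃ C : ℝ × ℝ × ℝ × ℝ × ℝ → ℝ,
      ContinuousOn C (Ici 0 ×ˢ Ici 0 ×ˢ Ici 0 ×ˢ Ioi 0 ×ˢ Ioi 0) ∧
      ∀ (ι : Type*) (p : ι → Measure ℝ) (lam : ι → ℝ) (φ : ι → ℝ → ℝ) (Ψ : ι → Measure ℝ)
        (τ T : ℝ), IsUniformFamily p lam φ Ψ τ T →
        -- the splitting of the renewal measures to which `A₁` and `A₂` refer
        (∀ i, renewalMeasure (p i) =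
          (volume.withDensity fun x =>
            ENNReal.ofReal (renewalDensity (p i) (lam i) (φ i) (Ψ i) x))
          + finitePart (lam i) (Ψ i)) ∧
        -- uniqueness
        (∀ (η : ℝ) (z : ι → ℝ → ℝ), η ∈ Ioo 0 τ → expSup η z < ∞ →
          ∀ Z Z' : ι → ℝ → ℝ, IsSubexpSolution p z Z → IsSubexpSolution p z Z' →
            ∀ i, EqOn (Z i) (Z' i) (Ici 0)) ∧
        -- convergence
        (∀ (η : ℝ) (z : ι → ℝ → ℝ), η ∈ Ioo 0 τ → expSup η z < ∞ →
          ∀ Z : ι → ℝ → ℝ, IsSubexpSolution p z Z →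
            ∀ i, Tendsto (Z i) atTop (𝓝 (renewalLimit (p i) (z i) (Z i)))) ∧
        -- uniform exponential rate
        ∃ r₀ > 0, ∀ r ∈ Ioo 0 r₀,
          A₁ p lam φ Ψ r < ∞ ∧ A₂ lam Ψ r < ∞ ∧
          ∀ (η : ℝ) (z : ι → ℝ → ℝ), η ∈ Ioo 0 τ → expSup η z < ∞ →
            ∀ Z : ι → ℝ → ℝ, IsSubexpSolution p z Z →
              ∀ i, ∀ x > 0,
                Real.exp ((1 / 2 * min η r) * x) * |Z i x - renewalLimit (p i) (z i) (Z i)| ≤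
                  C ((A₁ p lam φ Ψ r).toReal, (A₂ lam Ψ r).toReal,
                    (max (expSup η z) (expSup (-η) Z * expMoment p τ)).toReal, η, r) := by
  refine ⟨rateConst, continuousOn_rateConst, fun ι p lam φ Ψ τ T h => ?_⟩
  obtain ⟨b, hbτ, hb⟩ := h.exists_bounds
  obtain ⟨r₀, c, ha⟩ := exists_isAdmissible b
  refine ⟨fun i => ?_, fun η z _ _ Z Z' hZ hZ' i => ?_, fun η z hη hz Z hZ i => ?_, r₀, ha.r_pos,
    fun r hr => ⟨h.A₁_lt_top hb ha hr, h.A₂_lt_top hb ha hr, fun η z hη hz Z hZ i x hx =>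
      h.exp_mul_abs_sub_le hbτ hb hr.1 (h.A₁_lt_top hb ha hr) (h.A₂_lt_top hb ha hr) hη hz hZ i
        hx⟩⟩
  · have := h.prob_right i
    rw [h.renewalDensity_eq, finitePart_eq]
    exact (hb i).renewalMeasure_eq_add
  · exact (hb i).renewalSolution_unique (hZ.1 i) (hZ'.1 i) (isSubexp_of_isSubexpSolution hZ i)
      (isSubexp_of_isSubexpSolution hZ' i)
  · have hr : r₀ / 2 ∈ Ioo 0 r₀ := ⟨half_pos ha.r_pos, half_lt_self ha.r_pos⟩
    have hα : 0 < 1 / 2 * min η (r₀ / 2) := by have := lt_min hη.1 hr.1; positivity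
    set K := rateConst ((A₁ p lam φ Ψ (r₀ / 2)).toReal, (A₂ lam Ψ (r₀ / 2)).toReal,
        (max (expSup η z) (expSup (-η) Z * expMoment p τ)).toReal, η, r₀ / 2)
    have hl : Tendsto (fun x => K * Real.exp (-((1 / 2 * min η (r₀ / 2)) * x))) atTop (𝓝 0) := by
      simpa using (Real.tendsto_exp_neg_atTop_nhds_zero.comp
        (tendsto_id.const_mul_atTop hα)).const_mul K
    rw [tendsto_iff_norm_sub_tendsto_zero]
    refine squeeze_zero' (.of_forall fun _ => norm_nonneg _) ?_ hl
    filter_upwards [eventually_gt_atTop 0] with x hx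
    have := h.exp_mul_abs_sub_le hbτ hb hr.1 (h.A₁_lt_top hb ha hr) (h.A₂_lt_top hb ha hr) hη hz hZ
      i hx
    rw [Real.exp_neg, ← div_eq_mul_inv, le_div_iff₀' (Real.exp_pos _)]
    exact this
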